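/- Let $\Omega$ be a finite set with $n$ elements, $\mathcal S_n$ its symmetric group and $\mathcal T_n$ the monoid of all maps $\Omega\to\Omega$; maps are written on the right and composed from left to right. For $b\in\mathcal T_n$ let $\ker(b)=\{(x,y): xb=yb\}$, let $\Omega b$ be the image of $b$ and $\operatorname{rank}(b)=|\Omega b|$; for $g\in\mathcal S_n$ let $\ker(b)g=\{(xg,yg):(x,y)\in\ker(b)\}$. Let $a\in\mathcal T_n\setminus\mathcal S_n$ and $G\le\mathcal S_n$ be such that $(a,G)$ is an $\mathcal S_n$-pair, that is, $\langle a,G\rangle\setminus G=\langle a,\mathcal S_n\rangle\setminus\mathcal S_n$, where $\langle\,\cdot\,\rangle$ denotes the generated subsemigroup. Put $S=\langle a,G\rangle\setminus G$ (which is a semigroup) and $r=\operatorname{rank}(a)$. Then: 1. $S=\{b\in\mathcal T_n : (\exists g\in\mathcal S_n)\ \ker(a)g\subseteq\ker(b)\}$. 2. $S$ is regular: for every $x\in S$ there is $y\in S$ with $x=xyx$. 3. $S$ is generated by its idempotents. 4. $S$ and $\langle g^{-1}ag\mid g\in G\rangle$ have the same idempotents. 5. $S=\langle g^{-1}ag\mid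 g\in G\rangle$. 6. $\langle a,G\rangle$ contains a constant map, $G$ is transitive on $\Omega$, and $S$ contains all the constant maps. 7. Every automorphism of $S$ has the form $s\mapsto g^{-1}sg$ for a unique $g$ in $N_{\mathcal S_n}(S)=\{g\in\mathcal S_n: g^{-1}Sg=S\}$, every such $g$ gives an automorphism, and this correspondence is a group isomorphism $\operatorname{Aut}(S)\cong N_{\mathcal S_n}(S)$. 8. $\operatorname{Aut}(S)\cong\mathcal S_n$. 9. The congruences of $S$ are the following. If $r=1$, every equivalence relation on $S$ is a congruence. If $r\ge2$, a relation on $S$ is a congruence if and only if it is of one of the following two kinds. * For an integer $k$ with $1\le k\le r+1$ and a normal subgroup $N$ of $\mathcal S_k$: $f$ and $g$ are related if and only if $f=g$, or both have rank less than $k$, or both have rank $k$, $\ker(f)=\ker(g)$, $\Omega f=\Omega g$, and the permutation $xf\mapsto xg$ of $\Omega f$ lies in $N$ (for some, equivalently every, identification of $\Omega f$ with $\{1,\dots,k\}$). * Only if all classes of $\ker(a)$ have exactly two elements (so $n=2r$), for a family $\mathcal P$ of subsets of $\Omega$ closed under complements: $f$ and $g$ are related if and only if $f=g$, or both have rank less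 than $r$, or both have rank $r$, $\ker(f)=\ker(g)$, and either $\Omega f=\Omega g$, or $\Omega f\in\mathcal P$ and $\Omega g=\Omega\setminus\Omega f$. 10. If $e^2=e\in S$, then $\{f\in S:\ker(f)=\ker(e),\ \Omega f=\Omega e\}$ is closed under multiplication and is isomorphic to $\mathcal S_{\operatorname{rank}(e)}$. 11. For all $b,c\in S$: $bS=cS$ if and only if $\ker(b)=\ker(c)$; $Sb=Sc$ if and only if $\Omega b=\Omega c$; $SbS=ScS$ if and only if $\operatorname{rank}(b)=\operatorname{rank}(c)$. Likewise Green's relations of $S$ are given by $b\,\mathcal R\,c\iff\ker(b)=\ker(c)$, $b\,\mathcal L\,c\iff\Omega b=\Omega c$, and $b\,\mathcal J\,c\iff\operatorname{rank}(b)=\operatorname{rank}(c)$. -/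

import Mathlib

open scoped Pointwise

/-- A transformation of the set `{0, …, n-1}`, an element of the full transformation monoid. -/
@[ext]
structure Transf (n : ℕ) where
  toFun : Fin n → Fin n

namespace Transf

variable {n : ℕ}

instance : FunLike (Transf n) (Fin n) (Fin n) where
  coe := Transf.toFun
  coe_injective _ _ h := Transf.ext h

/-- Maps act on the right: `a * b` is "first `a`, then `b`". -/
instance : Monoid (Transf n) where
  one := ⟨id⟩
  mul a b := ⟨fun x => b (a x)⟩
  mul_assoc _ _ _ := rfl
  one_mul _ := rfl
  mul_one _ := rfl

theorem mul_apply (a b : Transf n) (x : Fin n) : (a * b) x = b (a x) := rfl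

/-- A permutation, viewed as a transformation. -/
def ofPerm (g : Equiv.Perm (Fin n)) : Transf n := ⟨g⟩

theorem ofPerm_apply (g : Equiv.Perm (Fin n)) (x : Fin n) : ofPerm g x = g x := rfl

/-- The transformation with constant value `x`. -/
def const (x : Fin n) : Transf n := ⟨fun _ => x⟩

/-- The size of the image. -/
noncomputable def rank (a : Transf n) : ℕ := (Set.range a).ncard

/-- The kernel of `a`, as a set of pairs. -/
def kernel (a : Transf n) : Set (Fin n × Fin n) := {p | a p.1 = a p.2}

/-- The elements of a permutation group, viewed as transformations. -/
def permSet (G : Subgroup (Equiv.Perm (Fin n))) : Set (Transf n) := ofPerm '' (G : Set _)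

/-- The semigroup `⟨a, G⟩` generated by `a` and the elements of `G`. -/
def gen (a : Transf n) (G : Subgroup (Equiv.Perm (Fin n))) : Subsemigroup (Transf n) :=
  Subsemigroup.closure ({a} ∪ permSet G)

/-- `(a, G)` is an `H`-pair: `a` is not a permutation, and `⟨a, G⟩ \ G = ⟨a, H⟩ \ H`. -/
def IsPair (H : Subgroup (Equiv.Perm (Fin n))) (a : Transf n)
    (G : Subgroup (Equiv.Perm (Fin n))) : Prop :=
  a ∉ permSet (⊤ : Subgroup (Equiv.Perm (Fin n))) ∧
    (gen a G : Set (Transf n)) \ permSet G = (gen a H : Set (Transf n)) \ permSet H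

theorem bijective_of_mem_permSet {G : Subgroup (Equiv.Perm (Fin n))} {x : Transf n}
    (hx : x ∈ permSet G) : Function.Bijective x := by
  obtain ⟨g, -, rfl⟩ := hx
  exact g.bijective

theorem mem_permSet_top {x : Transf n} (hx : Function.Bijective x) :
    x ∈ permSet (⊤ : Subgroup (Equiv.Perm (Fin n))) :=
  ⟨Equiv.ofBijective x hx, Subgroup.mem_top _, rfl⟩

theorem bijective_left_right {x y : Transf n} (h : Function.Bijective (x * y : Transf n)) :
    Function.Bijective x ∧ Function.Bijective y := by
  have hx : Function.Injective x := Function.Injective.of_comp (f := y) h.1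
  have hy : Function.Surjective y := Function.Surjective.of_comp (g := x) h.2
  exact ⟨Finite.injective_iff_bijective.1 hx, Finite.surjective_iff_bijective.1 hy⟩

theorem mem_permSet_of_bijective {a : Transf n} {G : Subgroup (Equiv.Perm (Fin n))}
    (ha : a ∉ permSet (⊤ : Subgroup (Equiv.Perm (Fin n)))) {x : Transf n} (hx : x ∈ gen a G) :
    Function.Bijective x → x ∈ permSet G := by
  induction hx using Subsemigroup.closure_induction with
  | mem x hx =>
    intro hb
    rcases hx with rfl | hx
    · exact absurd (mem_permSet_top hb) ha
    · exact hx
  | mul x y _ _ ihx ihy =>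
    intro hb
    obtain ⟨bx, hy⟩ := bijective_left_right hb
    obtain ⟨g, hg, rfl⟩ := ihx bx
    obtain ⟨h, hh, rfl⟩ := ihy hy
    exact ⟨h * g, G.mul_mem hh hg, rfl⟩

/-- The semigroup `⟨a, G⟩ \ G`, for a singular transformation `a`. -/
def singularPart (a : Transf n) (G : Subgroup (Equiv.Perm (Fin n)))
    (ha : a ∉ permSet (⊤ : Subgroup (Equiv.Perm (Fin n)))) : Subsemigroup (Transf n) where
  carrier := (gen a G : Set (Transf n)) \ permSet G
  mul_mem' := by
    rintro x y ⟨hx, hx'⟩ ⟨hy, _⟩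
    refine ⟨(gen a G).mul_mem hx hy, fun h => hx' ?_⟩
    exact mem_permSet_of_bijective ha hx (bijective_left_right (bijective_of_mem_permSet h)).1

/-- The semigroup `⟨g⁻¹ a g | g ∈ G⟩`. -/
def conjGen (a : Transf n) (G : Subgroup (Equiv.Perm (Fin n))) : Subsemigroup (Transf n) :=
  Subsemigroup.closure {x | ∃ g ∈ G, x = ofPerm g⁻¹ * a * ofPerm g}

theorem conj_one (s : Transf n) : ofPerm (1 : Equiv.Perm (Fin n))⁻¹ * s * ofPerm 1 = s := rfl

theorem conj_mul (g h : Equiv.Perm (Fin n)) (s : Transf n) :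
    ofPerm (g * h)⁻¹ * s * ofPerm (g * h) =
      ofPerm g⁻¹ * (ofPerm h⁻¹ * s * ofPerm h) * ofPerm g := by
  ext x
  rw [mul_inv_rev]
  rfl

/-- The normalizer of `S` in the symmetric group: all `g` with `g⁻¹ S g = S`. -/
def normalizer (S : Subsemigroup (Transf n)) : Subgroup (Equiv.Perm (Fin n)) where
  carrier := {g | ∀ s : Transf n, s ∈ S ↔ ofPerm g⁻¹ * s * ofPerm g ∈ S}
  one_mem' _ := Iff.rfl
  mul_mem' {g h} hg hh s := by rw [conj_mul, ← hg, ← hh]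
  inv_mem' {g} hg s := by rw [hg (ofPerm g⁻¹⁻¹ * s * ofPerm g⁻¹), ← conj_mul, mul_inv_cancel, conj_one]

/-- The relation given by a positive integer `k` and a (normal) subgroup `N` of the symmetric group
of degree `k`: equal elements, any two elements of rank less than `k`, and any two elements of
rank `k` that have the same kernel and image and differ by a permutation in `N`. In the last
clause `p` numbers the kernel classes and `u` the points of the image. -/
def malcevRel (k : ℕ) (N : Subgroup (Equiv.Perm (Fin k))) (f g : Transf n) : Prop :=
  f = g ∨ (rank f < k ∧ rank g < k) ∨
    ∃ (p : Fin n → Fin k) (u : Fin k ↪ Fin n), Function.Surjective p ∧ ∃ σ ∈ N,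
      (∀ x, f x = u (p x)) ∧ ∀ x, g x = u (σ (p x))

/-- The relation given by an integer `r` and a family `P` of sets closed under complements: equal
elements, any two elements of rank less than `r`, and any two elements of rank `r` that have the
same kernel and whose images are equal or are complementary members of `P`. -/
def complementRel (r : ℕ) (P : Set (Set (Fin n))) (f g : Transf n) : Prop :=
  f = g ∨ (rank f < r ∧ rank g < r) ∨
    (rank f = r ∧ rank g = r ∧ kernel f = kernel g ∧
      (Set.range f = Set.range g ∨ (Set.range f ∈ P ∧ Set.range g = (Set.range f)ᶜ)))

/-- Green's relation R of `S`: `b` and `c` generate the same principal right ideal. -/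
def GreenR (S : Subsemigroup (Transf n)) (b c : Transf n) : Prop :=
  {b} ∪ {b} * (S : Set (Transf n)) = {c} ∪ {c} * (S : Set (Transf n))

/-- Green's relation L of `S`: `b` and `c` generate the same principal left ideal. -/
def GreenL (S : Subsemigroup (Transf n)) (b c : Transf n) : Prop :=
  {b} ∪ (S : Set (Transf n)) * {b} = {c} ∪ (S : Set (Transf n)) * {c}

/-- The principal two-sided ideal of `S` generated by `b`. -/
def principalIdeal (S : Subsemigroup (Transf n)) (b : Transf n) : Set (Transf n) :=
  {b} ∪ {b} * (S : Set (Transf n)) ∪ (S : Set (Transf n)) * {b} ∪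
    (S : Set (Transf n)) * {b} * (S : Set (Transf n))

/-- Green's relation J of `S`: `b` and `c` generate the same principal two-sided ideal. -/
def GreenJ (S : Subsemigroup (Transf n)) (b c : Transf n) : Prop :=
  principalIdeal S b = principalIdeal S c

end Transf

/-! ### Extending partial injections to permutations, and the maps that make up S. -/

namespace Transf

variable {n : ℕ}

/-! Membership in S depends only on the kernel. A non-permutation word in `a` and G begins with a
permutation followed by `a`, so its kernel contains a translate of ker(a). Conversely, any such map
is obtained from `a` and permutations by merging image points one pair at a time, with a point
outside the image as spare room (`KerLe.mem_gen_top`). Hence S absorbs all maps on the right and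
permutations on the left, contains the constants, and has elements with prescribed values on any r
points. Regularity, Green's relations and the maximal subgroups follow, and an automorphism is
determined by how it permutes the constants.

The group G itself matters in two places. Pushing group letters to the right writes an element of S
as cg with c a product of conjugates of `a`; when cg is idempotent, taking powers makes the factor g
disappear, and S is generated by its idempotents. Also, all maps of rank r in S meet a given G-orbit
in equally many points, although S contains ak for every permutation k; this forces transitivity.

For congruences with r at least 2, a related pair of unequal ranks puts all elements up to the
larger rank into one class (`collapsed_of_rank_lt`). A related pair of equal rank with different
kernels or images can usually be multiplied into such a pair. The exception is a pair with disjoint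
images of size r when no kernel class of `a` has three points; counting then gives n = 2r. A
nontrivial pair of equal rank at least 2 also collapses all lower ranks (`collapsed_pred`), so only
one rank carries structure: a normal subgroup or a family of complementary sets. -/

theorem exists_perm_eqOn (s : Set (Fin n)) (f : Fin n → Fin n) (hf : Set.InjOn f s) :
    ∃ g : Equiv.Perm (Fin n), ∀ i ∈ s, g i = f i := by
  obtain ⟨g, hg⟩ := Set.MapsTo.exists_equiv_extend_of_card_eq (t := (Finset.univ : Finset (Fin n)))
    (by simp) (s := s) (f := f) (fun _ _ => by simp) hf
  exact ⟨g.trans (Equiv.subtypeUnivEquiv (by simp)), hg⟩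

theorem ofPerm_inv_mul_cancel (g : Equiv.Perm (Fin n)) (b : Transf n) :
    ofPerm g⁻¹ * (ofPerm g * b) = b :=
  DFunLike.ext _ _ fun x => congrArg b (g.apply_symm_apply x)

/-- The assignment of c x to b x is a well-defined injection on the image of b, so it extends to a
permutation. -/
theorem exists_mul_ofPerm {b c : Transf n} (h : ∀ x y, b x = b y ↔ c x = c y) :
    ∃ g : Equiv.Perm (Fin n), c = b * ofPerm g := by
  have hfac : Function.FactorsThrough c b := fun x y hxy => (h x y).1 hxy
  obtain ⟨g, hg⟩ := exists_perm_eqOn (Set.range b) (Function.extend b c id) (by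
    rintro _ ⟨x, rfl⟩ _ ⟨y, rfl⟩ hxy
    rw [hfac.extend_apply, hfac.extend_apply] at hxy
    exact (h x y).2 hxy)
  refine ⟨g, DFunLike.ext _ _ fun x => ?_⟩
  rw [mul_apply, ofPerm_apply, hg _ ⟨x, rfl⟩, hfac.extend_apply]

theorem exists_injOn_mapsTo {A B : Set (Fin n)} (h : A.ncard ≤ B.ncard) :
    ∃ j : Fin n → Fin n, Set.InjOn j A ∧ ∀ x ∈ A, j x ∈ B := by
  rcases A.eq_empty_or_nonempty with rfl | ⟨x, hx⟩
  · exact ⟨id, by simp, by simp⟩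
  · have : Nonempty (Fin n) := ⟨x⟩
    obtain ⟨j, hj, hi⟩ := A.toFinite.exists_injOn_of_encard_le (t := B) (by
      rw [← A.toFinite.cast_ncard_eq, ← B.toFinite.cast_ncard_eq]; exact_mod_cast h)
    exact ⟨j, hi, fun x hx => hj hx⟩

/-- A permutation that carries `x` and `y` into one kernel class of `a`, and a set `A` injectively
into the remaining classes. -/
theorem exists_perm_merge (a : Transf n) {p q x y : Fin n} (hpq : p ≠ q) (h : a p = a q)
    (hxy : x ≠ y) {A : Set (Fin n)} (hx : x ∉ A) (hy : y ∉ A) (hA : A.ncard + 1 ≤ rank a) :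
    ∃ g : Equiv.Perm (Fin n), g x = p ∧ g y = q ∧ Set.InjOn (fun z => a (g z)) A ∧
      ∀ z ∈ A, a (g z) ≠ a p := by
  have : Nonempty (Fin n) := ⟨x⟩
  obtain ⟨j, hj, hm⟩ := exists_injOn_mapsTo (A := A) (B := Set.range a \ {a p}) (by
    rw [Set.ncard_sdiff_singleton_of_mem (Set.mem_range_self p)]
    exact Nat.le_sub_of_add_le hA)
  have hsec : ∀ z ∈ A, a (Function.invFun a (j z)) = j z := fun z hz =>
    Function.invFun_eq (hm z hz).1
  have hne : ∀ z ∈ A, a (Function.invFun a (j z)) ≠ a p := fun z hz => by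
    rw [hsec z hz]; exact (hm z hz).2
  obtain ⟨g, hg⟩ := exists_perm_eqOn (insert x (insert y A))
    (fun z => if z = x then p else if z = y then q else Function.invFun a (j z)) (by
      have hne' : ∀ z ∈ A, a (Function.invFun a (j z)) ≠ a q := h ▸ hne
      rintro u hu v hv huv
      have key : ∀ u ∈ A, ∀ v ∈ A, Function.invFun a (j u) = Function.invFun a (j v) → u = v :=
        fun u hu v hv e => hj hu hv (by rw [← hsec u hu, e, hsec v hv])
      rcases hu with rfl | rfl | hu <;> rcases hv with rfl | rfl | hv <;> grind)
  have e : ∀ z ∈ A, g z = Function.invFun a (j z) := fun z hz => by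
    rw [hg z (by simp [hz]), if_neg (by rintro rfl; exact hx hz), if_neg (by rintro rfl; exact hy hz)]
  refine ⟨g, ?_, ?_, ?_, fun z hz => by rw [e z hz]; exact hne z hz⟩
  · rw [hg x (by simp)]; simp
  · rw [hg y (by simp)]; simp [hxy.symm]
  · intro u hu v hv huv
    simp only [e u hu, e v hv, hsec u hu, hsec v hv] at huv
    exact hj hu hv huv

/-- Applied to A without x, `exists_perm_merge` leaves the class of p free, and x may occupy it. -/
theorem exists_perm_injOn_merge (a : Transf n) (ha : ¬ Function.Injective a) {A : Set (Fin n)}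
    (hA : A.ncard ≤ rank a) {x y : Fin n} (hx : x ∈ A) (hy : y ∉ A) :
    ∃ g : Equiv.Perm (Fin n), Set.InjOn (fun z => a (g z)) A ∧ a (g x) = a (g y) := by
  obtain ⟨p, q, h, hpq⟩ : ∃ p q, a p = a q ∧ p ≠ q := by
    simpa [Function.Injective] using ha
  obtain ⟨g, gx, gy, hi, hn⟩ := exists_perm_merge a hpq h (x := x) (y := y) (A := A \ {x})
    (by rintro rfl; exact hy hx) (by simp) (by simp [hy]) (by
      rw [Set.ncard_sdiff_singleton_add_one hx]; exact hA)
  refine ⟨g, ?_, by rw [gx, gy, h]⟩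
  intro u hu v hv huv
  by_cases hux : u = x <;> by_cases hvx : v = x
  · rw [hux, hvx]
  · subst hux
    exact absurd (by simpa [gx] using huv.symm) (hn v ⟨hv, hvx⟩)
  · subst hvx
    exact absurd (by simpa [gx] using huv) (hn u ⟨hu, hux⟩)
  · exact hi ⟨hu, hux⟩ ⟨hv, hvx⟩ huv

/-- A product of `a` with permutations that fixes `A` pointwise and moves `y` to `x`. -/
theorem exists_perm_retract (a : Transf n) (ha : ¬ Function.Injective a) {A : Set (Fin n)}
    (hA : A.ncard ≤ rank a) {x y : Fin n} (hx : x ∈ A) (hy : y ∉ A) :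
    ∃ g k : Equiv.Perm (Fin n), (∀ z ∈ A, k (a (g z)) = z) ∧ k (a (g y)) = x := by
  obtain ⟨g, hi, he⟩ := exists_perm_injOn_merge a ha hA hx hy
  have : Nonempty (Fin n) := ⟨x⟩
  obtain ⟨k, hk⟩ := exists_perm_eqOn ((fun z => a (g z)) '' A)
    (Function.invFunOn (fun z => a (g z)) A) (Function.invFunOn_injOn_image _ _)
  have hfix : ∀ z ∈ A, k (a (g z)) = z := fun z hz => by
    rw [hk _ ⟨z, hz, rfl⟩]; exact hi.leftInvOn_invFunOn hz
  exact ⟨g, k, hfix, by rw [← he, hfix x hx]⟩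

/-- The kernel of `a` is contained in the kernel of `b`. -/
def KerLe (a b : Transf n) : Prop := ∀ x y, a x = a y → b x = b y

theorem KerLe.exists_eq_extend {a b : Transf n} (h : KerLe a b) :
    ∃ t : Transf n, b = a * t := by
  refine ⟨⟨Function.extend a b id⟩, DFunLike.ext _ _ fun x => ?_⟩
  exact (Function.FactorsThrough.extend_apply (fun x y hxy => h x y hxy) _ x).symm

theorem range_mul (a b : Transf n) : Set.range (a * b : Transf n) = b '' Set.range a :=
  Set.range_comp b a

theorem rank_mul_le_left (a b : Transf n) : rank (a * b) ≤ rank a := by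
  rw [rank, range_mul]; exact Set.ncard_image_le

theorem rank_mul_le_right (a b : Transf n) : rank (a * b) ≤ rank b := by
  rw [rank, range_mul]; exact Set.ncard_le_ncard (Set.image_subset_range _ _)

theorem KerLe.rank_le {a b : Transf n} (h : KerLe a b) : rank b ≤ rank a := by
  obtain ⟨t, rfl⟩ := h.exists_eq_extend
  exact rank_mul_le_left a t

theorem rank_mul_eq_iff (a b : Transf n) : rank (a * b) = rank a ↔ Set.InjOn b (Set.range a) := by
  rw [rank, range_mul]
  exact ⟨fun h => Set.injOn_of_ncard_image_eq h, fun h => Set.InjOn.ncard_image h⟩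

theorem KerLe.ker_eq {a b : Transf n} (h : KerLe a b) (hr : rank a = rank b) (x y : Fin n) :
    a x = a y ↔ b x = b y := by
  refine ⟨h x y, fun hxy => ?_⟩
  obtain ⟨t, rfl⟩ := h.exists_eq_extend
  exact (rank_mul_eq_iff a t).1 hr.symm ⟨x, rfl⟩ ⟨y, rfl⟩ hxy

theorem rank_lt_of_not_injective {a : Transf n} (ha : ¬ Function.Injective a) : rank a < n := by
  have h1 : rank a ≤ n := by
    rw [rank]
    simpa using Set.ncard_le_card (Set.range a)
  refine lt_of_le_of_ne h1 fun h => ha ?_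
  rw [← Set.injOn_univ]
  refine Set.injOn_of_ncard_image_eq ?_
  rw [Set.image_univ, Set.ncard_univ, Nat.card_eq_fintype_card, Fintype.card_fin]
  exact h

theorem exists_notMem_range {a : Transf n} (h : rank a < n) : ∃ w, w ∉ Set.range a := by
  by_contra hc
  push Not at hc
  have : Set.range a = Set.univ := Set.eq_univ_of_forall hc
  rw [rank, this, Set.ncard_univ, Nat.card_eq_fintype_card, Fintype.card_fin] at h
  exact lt_irrefl _ h

theorem ofPerm_mem_gen_top (a : Transf n) (g : Equiv.Perm (Fin n)) : ofPerm g ∈ gen a ⊤ :=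
  Subsemigroup.subset_closure (Or.inr ⟨g, Subgroup.mem_top g, rfl⟩)

theorem self_mem_gen (a : Transf n) (G : Subgroup (Equiv.Perm (Fin n))) : a ∈ gen a G :=
  Subsemigroup.subset_closure (Or.inl rfl)

/-- Every map with a larger kernel than `a` is generated by `a` and the symmetric group. -/
theorem KerLe.mem_gen_top {a : Transf n} (ha : ¬ Function.Injective a) {b : Transf n}
    (h : KerLe a b) : b ∈ gen a ⊤ := by
  obtain ⟨d, hd⟩ := Nat.exists_eq_add_of_le h.rank_le
  induction d generalizing b with
  | zero =>
    obtain ⟨g, rfl⟩ := exists_mul_ofPerm (h.ker_eq hd)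
    exact (gen a ⊤).mul_mem (self_mem_gen a ⊤) (ofPerm_mem_gen_top a g)
  | succ d ih =>
    obtain ⟨x, y, hb, hxy⟩ : ∃ x y, b x = b y ∧ a x ≠ a y := by
      by_contra hc
      push Not at hc
      have := KerLe.rank_le (a := b) (b := a) hc
      omega
    have hbn : rank b < n := lt_of_le_of_lt h.rank_le (rank_lt_of_not_injective ha)
    obtain ⟨w, hw⟩ := exists_notMem_range hbn
    -- c undoes one merger of b: the class of y gets the new value w, while x, in another class of
    -- `a`, keeps the old value in the image. The rank grows by one, so induction applies to c.
    let c : Transf n := ⟨fun z => if a z = a y then w else b z⟩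
    have hc : ∀ z, c z = if a z = a y then w else b z := fun z => rfl
    have hrange : Set.range c = insert w (Set.range b) := by
      ext v
      constructor
      · rintro ⟨z, rfl⟩
        rw [hc]
        split_ifs
        · exact Or.inl rfl
        · exact Or.inr ⟨z, rfl⟩
      · rintro (rfl | ⟨z, rfl⟩)
        · exact ⟨y, by rw [hc, if_pos rfl]⟩
        · by_cases hz : a z = a y
          · exact ⟨x, by rw [hc, if_neg hxy, hb, h z y hz]⟩
          · exact ⟨z, by rw [hc, if_neg hz]⟩
    have hrank : rank c = rank b + 1 := by
      rw [rank, hrange, Set.ncard_insert_of_notMem hw, rank]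
    have hac : KerLe a c := fun u v huv => by
      rw [hc, hc, huv, h u v huv]
    have hcm := ih hac (by omega)
    -- The retraction sends w back to b y and fixes the image of b, which recovers b from c.
    obtain ⟨g, k, hfix, hmv⟩ := exists_perm_retract a ha h.rank_le (Set.mem_range_self y) hw
    have : b = c * (ofPerm g * a * ofPerm k) := by
      refine DFunLike.ext _ _ fun z => ?_
      change b z = k (a (g (c z)))
      rw [hc]
      split_ifs with hz
      · rw [hmv]; exact h z y hz
      · rw [hfix _ ⟨z, rfl⟩]
    rw [this]
    exact (gen a ⊤).mul_mem hcm ((gen a ⊤).mul_mem ((gen a ⊤).mul_mem (ofPerm_mem_gen_top a g)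
      (self_mem_gen a ⊤)) (ofPerm_mem_gen_top a k))

theorem not_injective_of_not_mem_permSet {a : Transf n}
    (ha : a ∉ permSet (⊤ : Subgroup (Equiv.Perm (Fin n)))) : ¬ Function.Injective a := fun h =>
  ha (mem_permSet_top (Finite.injective_iff_bijective.1 h))

/-- Isolating the first occurrence of `a` shows that the kernel of a word contains a translate of
ker(a). -/
theorem eq_mul_mul_of_mem_gen {a : Transf n} {G : Subgroup (Equiv.Perm (Fin n))} {b : Transf n}
    (hb : b ∈ gen a G) : b ∈ permSet G ∨
      ∃ g ∈ G, ∃ w : Transf n, b = ofPerm g * a * w := by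
  induction hb using Subsemigroup.closure_induction with
  | mem x hx =>
    rcases hx with rfl | hx
    · exact Or.inr ⟨1, G.one_mem, 1, rfl⟩
    · exact Or.inl hx
  | mul x y _ _ ihx ihy =>
    rcases ihx with ⟨g, hg, rfl⟩ | ⟨g, hg, w, rfl⟩
    · rcases ihy with ⟨k, hk, rfl⟩ | ⟨k, hk, w, rfl⟩
      · exact Or.inl ⟨k * g, G.mul_mem hk hg, rfl⟩
      · exact Or.inr ⟨k * g, G.mul_mem hk hg, w, rfl⟩
    · exact Or.inr ⟨g, hg, w * y, rfl⟩

/-- `S` consists of all the maps whose kernel contains a translate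
of the kernel of `a`. -/
def IsSingularSemigroup (a : Transf n) (S : Subsemigroup (Transf n)) : Prop :=
  ∀ b, b ∈ S ↔ ∃ g : Equiv.Perm (Fin n), KerLe a (ofPerm g * b)

theorem IsPair.isSingularSemigroup {a : Transf n} {G : Subgroup (Equiv.Perm (Fin n))}
    (h : IsPair ⊤ a G) : IsSingularSemigroup a (singularPart a G h.1) := by
  have ha := not_injective_of_not_mem_permSet h.1
  intro b
  have : b ∈ singularPart a G h.1 ↔ b ∈ (gen a ⊤ : Set (Transf n)) \ permSet ⊤ := by
    exact Set.ext_iff.1 h.2 b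
  rw [this]
  constructor
  · rintro ⟨hb, hb'⟩
    rcases eq_mul_mul_of_mem_gen hb with hb | ⟨g, -, w, rfl⟩
    · exact absurd hb hb'
    · refine ⟨g⁻¹, fun x y hxy => ?_⟩
      simp only [mul_apply, ofPerm_apply, hxy, ← Equiv.Perm.mul_apply, mul_inv_cancel, Equiv.Perm.one_apply]
  · rintro ⟨g, hg⟩
    have hm := hg.mem_gen_top ha
    constructor
    · have := (gen a ⊤).mul_mem (ofPerm_mem_gen_top a g⁻¹) hm
      rwa [ofPerm_inv_mul_cancel] at this
    · intro hb
      refine ha fun x y hxy => ?_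
      exact g.injective ((bijective_of_mem_permSet hb).1 (hg x y hxy))

namespace IsSingularSemigroup

variable {a : Transf n} {S : Subsemigroup (Transf n)}

theorem self_mem (hS : IsSingularSemigroup a S) : a ∈ S := (hS a).2 ⟨1, fun _ _ h => h⟩

theorem mem_of_kerLe (hS : IsSingularSemigroup a S) {b c : Transf n} (hb : b ∈ S)
    (h : KerLe b c) : c ∈ S := by
  obtain ⟨g, hg⟩ := (hS b).1 hb
  exact (hS c).2 ⟨g, fun x y hxy => h _ _ (hg x y hxy)⟩

theorem mul_mem_right (hS : IsSingularSemigroup a S) {b : Transf n} (hb : b ∈ S) (c : Transf n) :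
    b * c ∈ S := hS.mem_of_kerLe hb fun _ _ hxy => congrArg c hxy

theorem ofPerm_mul_mem (hS : IsSingularSemigroup a S) {b : Transf n} (hb : b ∈ S)
    (g : Equiv.Perm (Fin n)) : ofPerm g * b ∈ S := by
  obtain ⟨k, hk⟩ := (hS b).1 hb
  refine (hS _).2 ⟨g⁻¹ * k, fun x y hxy => ?_⟩
  simpa [mul_apply, ofPerm_apply] using hk x y hxy

theorem rank_le (hS : IsSingularSemigroup a S) {b : Transf n} (hb : b ∈ S) : rank b ≤ rank a := by
  obtain ⟨g, hg⟩ := (hS b).1 hb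
  refine le_trans (le_of_eq ?_) hg.rank_le
  have := (ofPerm_inv_mul_cancel g b).symm
  refine le_antisymm ?_ (rank_mul_le_right _ _)
  conv_lhs => rw [this]
  exact rank_mul_le_right _ _

theorem const_mem (hS : IsSingularSemigroup a S) (x : Fin n) : const x ∈ S :=
  hS.mem_of_kerLe hS.self_mem fun _ _ _ => rfl

/-- Following b by a section gives an idempotent e with the kernel of b, so b = eg for a permutation
g. Then g⁻¹e is in S and serves as the inverse: it sends b x to a point that b again sends to b x.
-/
theorem exists_regular_inverse (hS : IsSingularSemigroup a S) {b : Transf n} (hb : b ∈ S) :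
    ∃ y ∈ S, b = b * y * b := by
  rcases isEmpty_or_nonempty (Fin n) with hE | hE
  · exact ⟨b, hb, DFunLike.ext _ _ fun x => hE.elim x⟩
  let e : Transf n := b * ⟨Function.invFun b⟩
  have he : ∀ x, b (e x) = b x := fun x => Function.invFun_eq ⟨x, rfl⟩
  have hk : ∀ x y, e x = e y ↔ b x = b y := fun x y =>
    ⟨fun h => by rw [← he x, h, he], fun h => congrArg (Function.invFun b) h⟩
  obtain ⟨g, hg⟩ := exists_mul_ofPerm hk
  refine ⟨ofPerm g⁻¹ * e, hS.ofPerm_mul_mem (hS.mul_mem_right hb _) _, DFunLike.ext _ _ fun x => ?_⟩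
  change b x = b (e (g⁻¹ (b x)))
  have : g⁻¹ (b x) = e x := by
    rw [hg]; simp [mul_apply, ofPerm_apply]
  rw [this, he, he]

theorem exists_eq_mul_of_range_subset (hS : IsSingularSemigroup a S) {b d : Transf n}
    (hb : b ∈ S) (hd : d ∈ S) (h : Set.range d ⊆ Set.range b) : ∃ s ∈ S, d = s * b := by
  obtain ⟨y, hy, hby⟩ := hS.exists_regular_inverse hb
  refine ⟨d * y, S.mul_mem hd hy, DFunLike.ext _ _ fun x => ?_⟩
  obtain ⟨z, hz⟩ := h ⟨x, rfl⟩
  change d x = b (y (d x))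
  rw [← hz]
  exact DFunLike.congr_fun hby z

theorem exists_eq_mul_of_kerLe (hS : IsSingularSemigroup a S) {b d : Transf n}
    (hb : b ∈ S) (hd : d ∈ S) (h : KerLe b d) : ∃ t ∈ S, d = b * t := by
  obtain ⟨y, hy, hby⟩ := hS.exists_regular_inverse hb
  refine ⟨y * d, S.mul_mem hy hd, DFunLike.ext _ _ fun x => ?_⟩
  exact h _ _ (DFunLike.congr_fun hby x)

theorem exists_retract (hS : IsSingularSemigroup a S) (ha : ¬ Function.Injective a)
    {A : Set (Fin n)} (hA : A.ncard ≤ rank a) {x y : Fin n} (hx : x ∈ A) (hy : y ∉ A) :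
    ∃ s ∈ S, (∀ z ∈ A, s z = z) ∧ s y = x := by
  obtain ⟨g, k, h, h'⟩ := exists_perm_retract a ha hA hx hy
  exact ⟨ofPerm g * (a * ofPerm k), hS.ofPerm_mul_mem (hS.mul_mem_right hS.self_mem _) _, h, h'⟩

/-- An element of `S` that agrees with a given map on a small set. -/
theorem exists_eqOn (hS : IsSingularSemigroup a S) (ha : ¬ Function.Injective a)
    {A : Set (Fin n)} (hA : A.ncard ≤ rank a) (f : Fin n → Fin n) :
    ∃ s ∈ S, ∀ z ∈ A, s z = f z := by
  rcases A.eq_empty_or_nonempty with rfl | ⟨x, hx⟩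
  · exact ⟨a, hS.self_mem, by simp⟩
  · have : ∃ y, y ∉ A := by
      by_contra hc
      push Not at hc
      have h1 : A = Set.univ := Set.eq_univ_of_forall hc
      rw [h1, Set.ncard_univ, Nat.card_eq_fintype_card, Fintype.card_fin] at hA
      exact absurd (rank_lt_of_not_injective ha) (by omega)
    obtain ⟨y, hy⟩ := this
    obtain ⟨s, hs, h, -⟩ := hS.exists_retract ha hA hx hy
    exact ⟨s * ⟨f⟩, hS.mul_mem_right hs _, fun z hz => congrArg f (h z hz)⟩

theorem exists_idempotent_move (hS : IsSingularSemigroup a S) (ha : ¬ Function.Injective a)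
    {A : Set (Fin n)} (hA : A.ncard ≤ rank a) {x y : Fin n} (hx : x ∈ A) (hy : y ∉ A) :
    ∃ e ∈ S, e * e = e ∧ e x = y ∧ ∀ z ∈ A, z ≠ x → e z = z := by
  classical
  have hxy : x ≠ y := by rintro rfl; exact hy hx
  have hc : (insert y (A \ {x})).ncard = A.ncard := by
    rw [Set.ncard_insert_of_notMem (by simp [hy]), Set.ncard_sdiff_singleton_add_one hx]
  obtain ⟨s, hs, h1, h2⟩ := hS.exists_retract ha (hc.trans_le hA) (Set.mem_insert y _)
    (y := x) (by simp [hxy])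
  -- The element s fixes the set obtained from A by replacing x with y, but its image may be larger.
  -- Following s by a retraction q onto that set makes it idempotent.
  let q : Transf n := ⟨fun z => if z ∈ insert y (A \ {x}) then z else y⟩
  have hq : ∀ z ∈ insert y (A \ {x}), q z = z := fun z hz => if_pos hz
  have hq' : ∀ z, q z ∈ insert y (A \ {x}) := fun z => by
    change (if z ∈ insert y (A \ {x}) then z else y) ∈ _
    split_ifs with hz
    · exact hz
    · exact Set.mem_insert y _
  refine ⟨s * q, hS.mul_mem_right hs _, DFunLike.ext _ _ fun z => ?_, ?_, fun z hz hzx => ?_⟩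
  · change q (s (q (s z))) = q (s z)
    rw [h1 _ (hq' _), hq _ (hq' _)]
  · change q (s x) = y
    rw [h2, hq _ (Set.mem_insert y _)]
  · change q (s z) = z
    have : z ∈ insert y (A \ {x}) := Or.inr ⟨hz, hzx⟩
    rw [h1 _ this, hq _ this]

end IsSingularSemigroup

end Transf

/-! ### Generation by idempotents. -/

namespace Transf

variable {n : ℕ}

theorem mul_ofPerm_mul_ofPerm (c : Transf n) (g k : Equiv.Perm (Fin n)) :
    c * ofPerm g * ofPerm k = c * ofPerm (k * g) := rfl

theorem KerLe.of_eq_mul {b c d : Transf n} (h : c = b * d) : KerLe b c := by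
  rintro x y hxy
  subst h
  exact congrArg d hxy

namespace IsSingularSemigroup

variable {a : Transf n} {S : Subsemigroup (Transf n)}

theorem idempotentClosure_le (S : Subsemigroup (Transf n)) :
    Subsemigroup.closure {e | e ∈ S ∧ e * e = e} ≤ S :=
  (Subsemigroup.closure_le).2 fun _ he => he.1

/-- When y is not in the image of c, the transposition acts on that image as an idempotent of S that
moves x to y and fixes the other points. -/
theorem mul_swap_mem_of_notMem (hS : IsSingularSemigroup a S) (ha : ¬ Function.Injective a)
    {c : Transf n} (hc : c ∈ Subsemigroup.closure {e | e ∈ S ∧ e * e = e}) {x y : Fin n}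
    (hy : y ∉ Set.range c) :
    c * ofPerm (Equiv.swap x y) ∈ Subsemigroup.closure {e | e ∈ S ∧ e * e = e} := by
  have hcy : ∀ z, c z ≠ y := fun z hz => hy ⟨z, hz⟩
  by_cases hx : x ∈ Set.range c
  · obtain ⟨e, heS, he, hexy, hfix⟩ := hS.exists_idempotent_move ha
      (hS.rank_le (idempotentClosure_le S hc)) hx hy
    have : c * ofPerm (Equiv.swap x y) = c * e := DFunLike.ext _ _ fun z => by
      rw [mul_apply, mul_apply, ofPerm_apply]
      by_cases hz : c z = x
      · rw [hz, hexy, Equiv.swap_apply_left]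
      · rw [hfix _ ⟨z, rfl⟩ hz, Equiv.swap_apply_of_ne_of_ne hz (hcy z)]
    rw [this]
    exact Subsemigroup.mul_mem _ hc (Subsemigroup.subset_closure ⟨heS, he⟩)
  · have : c * ofPerm (Equiv.swap x y) = c := DFunLike.ext _ _ fun z => by
      rw [mul_apply, ofPerm_apply, Equiv.swap_apply_of_ne_of_ne (fun hz => hx ⟨z, hz⟩) (hcy z)]
    rwa [this]

/-- If both x and y are image points, a point w outside the image serves as a buffer: (x w), (x y),
(w y) applied in this order give (x y), and each has an endpoint that the current image misses. -/
theorem mul_swap_mem (hS : IsSingularSemigroup a S) (ha : ¬ Function.Injective a)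
    {c : Transf n} (hc : c ∈ Subsemigroup.closure {e | e ∈ S ∧ e * e = e}) {x y : Fin n}
    (hxy : x ≠ y) :
    c * ofPerm (Equiv.swap x y) ∈ Subsemigroup.closure {e | e ∈ S ∧ e * e = e} := by
  by_cases hy : y ∈ Set.range c
  swap
  · exact hS.mul_swap_mem_of_notMem ha hc hy
  by_cases hx : x ∈ Set.range c
  swap
  · rw [Equiv.swap_comm]; exact hS.mul_swap_mem_of_notMem ha hc hx
  obtain ⟨w, hw⟩ := exists_notMem_range
    (lt_of_le_of_lt (hS.rank_le (idempotentClosure_le S hc)) (rank_lt_of_not_injective ha))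
  have hwx : w ≠ x := by rintro rfl; exact hw hx
  have hwy : w ≠ y := by rintro rfl; exact hw hy
  have hcw : ∀ z, c z ≠ w := fun z hz => hw ⟨z, hz⟩
  have h1 := hS.mul_swap_mem_of_notMem ha hc (x := x) hw
  have h2 := hS.mul_swap_mem_of_notMem ha h1 (x := y) (y := x) (by
    rintro ⟨z, hz⟩
    rw [mul_apply, ofPerm_apply] at hz
    have := hcw z
    grind)
  have h3 := hS.mul_swap_mem_of_notMem ha h2 (x := w) (y := y) (by
    rintro ⟨z, hz⟩
    rw [mul_apply, mul_apply, ofPerm_apply, ofPerm_apply] at hz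
    have := hcw z
    grind)
  rw [mul_ofPerm_mul_ofPerm, mul_ofPerm_mul_ofPerm] at h3
  convert h3 using 3
  ext z
  simp only [Equiv.Perm.mul_apply]
  grind

theorem mul_ofPerm_mem_idempotentClosure (hS : IsSingularSemigroup a S)
    (ha : ¬ Function.Injective a) {c : Transf n}
    (hc : c ∈ Subsemigroup.closure {e | e ∈ S ∧ e * e = e}) (g : Equiv.Perm (Fin n)) :
    c * ofPerm g ∈ Subsemigroup.closure {e | e ∈ S ∧ e * e = e} := by
  induction g using Equiv.Perm.swap_induction_on with
  | one => exact hc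
  | swap_mul f x y hxy ih => exact hS.mul_swap_mem ha ih hxy

theorem exists_idempotent_kernel (hS : IsSingularSemigroup a S) {b : Transf n} (hb : b ∈ S) :
    ∃ e ∈ S, e * e = e ∧ ∀ x y, e x = e y ↔ b x = b y := by
  obtain ⟨y, hy, hby⟩ := hS.exists_regular_inverse hb
  refine ⟨b * y, S.mul_mem hb hy, ?_, fun u v => ⟨fun h => ?_, fun h => congrArg y h⟩⟩
  · rw [← mul_assoc, ← hby]
  · exact KerLe.of_eq_mul hby u v h

/-- Each b is eg with e an idempotent of the same kernel; g is a product of transpositions, which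
are absorbed one at a time. -/
theorem eq_idempotentClosure (hS : IsSingularSemigroup a S) (ha : ¬ Function.Injective a) :
    S = Subsemigroup.closure {e | e ∈ S ∧ e * e = e} := by
  refine le_antisymm (fun b hb => ?_) (idempotentClosure_le S)
  obtain ⟨e, heS, he, hk⟩ := hS.exists_idempotent_kernel hb
  obtain ⟨g, rfl⟩ := exists_mul_ofPerm hk
  exact hS.mul_ofPerm_mem_idempotentClosure ha (Subsemigroup.subset_closure ⟨heS, he⟩) g

theorem conjGen_le (hS : IsSingularSemigroup a S) (G : Subgroup (Equiv.Perm (Fin n))) :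
    conjGen a G ≤ S := by
  refine (Subsemigroup.closure_le).2 ?_
  rintro _ ⟨g, -, rfl⟩
  exact hS.mul_mem_right (hS.ofPerm_mul_mem hS.self_mem _) _

end IsSingularSemigroup

/-! ### Conjugates of `a` under G, and transitivity of G. -/

variable {a : Transf n} {G : Subgroup (Equiv.Perm (Fin n))}

theorem conj_mem_conjGen {c : Transf n} (hc : c ∈ conjGen a G) {g : Equiv.Perm (Fin n)}
    (hg : g ∈ G) : ofPerm g * c * ofPerm g⁻¹ ∈ conjGen a G := by
  induction hc using Subsemigroup.closure_induction with
  | mem x hx =>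
    obtain ⟨k, hk, rfl⟩ := hx
    refine Subsemigroup.subset_closure ⟨g⁻¹ * k, G.mul_mem (G.inv_mem hg) hk, ?_⟩
    rw [conj_mul, inv_inv]
  | mul x y _ _ ihx ihy =>
    have : ofPerm g * (x * y) * ofPerm g⁻¹ =
        (ofPerm g * x * ofPerm g⁻¹) * (ofPerm g * y * ofPerm g⁻¹) :=
      DFunLike.ext _ _ fun z => by
        simp only [mul_apply, ofPerm_apply, ← Equiv.Perm.mul_apply g g⁻¹, mul_inv_cancel,
          Equiv.Perm.one_apply]
    rw [this]
    exact Subsemigroup.mul_mem _ ihx ihy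

theorem ofPerm_mul_eq_conj (g : Equiv.Perm (Fin n)) (c d : Transf n) :
    ofPerm g * (c * d) = (ofPerm g * c * ofPerm g⁻¹) * (ofPerm g * d) :=
  DFunLike.ext _ _ fun _ => congrArg d (g.apply_symm_apply _).symm

/-- The identity gcd = (gcg⁻¹)gd moves the letters from G to the right end, at the cost of
conjugating the factors they pass. -/
theorem eq_conjGen_mul_of_mem_gen {b : Transf n} (hb : b ∈ gen a G) :
    b ∈ permSet G ∨ ∃ c ∈ conjGen a G, ∃ g ∈ G, b = c * ofPerm g := by
  induction hb using Subsemigroup.closure_induction with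
  | mem x hx =>
    rcases hx with rfl | hx
    · exact Or.inr ⟨x, Subsemigroup.subset_closure ⟨1, G.one_mem, rfl⟩, 1, G.one_mem, rfl⟩
    · exact Or.inl hx
  | mul x y _ _ ihx ihy =>
    rcases ihx with ⟨g, hg, rfl⟩ | ⟨c, hc, g, hg, rfl⟩ <;>
      rcases ihy with ⟨k, hk, rfl⟩ | ⟨d, hd, k, hk, rfl⟩
    · exact Or.inl ⟨k * g, G.mul_mem hk hg, rfl⟩
    · exact Or.inr ⟨_, conj_mem_conjGen hd hg, k * g, G.mul_mem hk hg, ofPerm_mul_eq_conj g d _⟩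
    · exact Or.inr ⟨c, hc, k * g, G.mul_mem hk hg, rfl⟩
    · refine Or.inr ⟨_, Subsemigroup.mul_mem _ hc (conj_mem_conjGen hd hg), k * g,
        G.mul_mem hk hg, ?_⟩
      rw [mul_assoc c, ofPerm_mul_eq_conj g d, mul_assoc c]
      rfl

/-- An idempotent cg equals all its powers, and (cg)ᵐ is a product of conjugates of c followed by
gᵐ. Taking m to be the order of g removes the group factor. -/
theorem mem_conjGen_of_idempotent {c : Transf n} (hc : c ∈ conjGen a G) {g : Equiv.Perm (Fin n)}
    (hg : g ∈ G) (he : (c * ofPerm g) * (c * ofPerm g) = c * ofPerm g) :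
    c * ofPerm g ∈ conjGen a G := by
  have key : ∀ m : ℕ, ∃ d ∈ conjGen a G, c * ofPerm g = d * ofPerm (g ^ (m + 1)) := by
    intro m
    induction m with
    | zero => exact ⟨c, hc, by rw [zero_add, pow_one]⟩
    | succ m ih =>
      obtain ⟨d, hd, hdm⟩ := ih
      refine ⟨_, Subsemigroup.mul_mem _ hd (conj_mem_conjGen hc (G.pow_mem hg (m + 1))), ?_⟩
      conv_lhs => rw [← he]
      nth_rewrite 1 [hdm]
      rw [mul_assoc d, ofPerm_mul_eq_conj, mul_assoc d, pow_succ' g (m + 1)]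
      rfl
  -- The exponent in `key` is m + 1, hence the order minus one.
  obtain ⟨d, hd, h⟩ := key (orderOf g - 1)
  rw [Nat.sub_add_cancel (orderOf_pos g), pow_orderOf_eq_one] at h
  rw [h]
  exact hd

theorem exists_eq_mul_self_mul_of_mem_gen {b : Transf n} (hb : b ∈ gen a G) :
    b ∈ permSet G ∨ ∃ g ∈ G, ∃ w : Transf n, b = w * a * ofPerm g := by
  induction hb using Subsemigroup.closure_induction with
  | mem x hx =>
    rcases hx with rfl | hx
    · exact Or.inr ⟨1, G.one_mem, 1, rfl⟩
    · exact Or.inl hx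
  | mul x y _ _ ihx ihy =>
    rcases ihy with ⟨k, hk, rfl⟩ | ⟨k, hk, w, rfl⟩
    · rcases ihx with ⟨g, hg, rfl⟩ | ⟨g, hg, w, rfl⟩
      · exact Or.inl ⟨k * g, G.mul_mem hk hg, rfl⟩
      · exact Or.inr ⟨k * g, G.mul_mem hk hg, w, rfl⟩
    · exact Or.inr ⟨k, hk, x * w, rfl⟩

/-- Isolating the last `a` places the image of b inside a G-translate of the image of `a`. Equal
rank makes this an equality, and translation by G preserves orbits. -/
theorem ncard_range_inter_orbit {S : Subsemigroup (Transf n)} (h : IsPair ⊤ a G)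
    (hS : S = singularPart a G h.1) {b : Transf n} (hb : b ∈ S) (hr : rank b = rank a)
    (x : Fin n) :
    (Set.range b ∩ MulAction.orbit G x).ncard = (Set.range a ∩ MulAction.orbit G x).ncard := by
  rw [hS] at hb
  rcases exists_eq_mul_self_mul_of_mem_gen hb.1 with hb' | ⟨g, hg, w, rfl⟩
  · exact absurd hb' hb.2
  · have hsub : Set.range (w * a * ofPerm g : Transf n) ⊆ g '' Set.range a := by
      rintro _ ⟨z, rfl⟩
      exact ⟨a (w z), ⟨w z, rfl⟩, rfl⟩
    have heq := Set.eq_of_subset_of_ncard_le hsub (by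
      rw [Set.ncard_image_of_injective _ g.injective]
      exact hr.ge)
    have horb : MulAction.orbit G x = g '' MulAction.orbit G x := by
      ext z
      constructor
      · rintro ⟨k, rfl⟩
        exact ⟨g⁻¹ (k • x), ⟨⟨g, hg⟩⁻¹ * k, rfl⟩, g.apply_symm_apply _⟩
      · rintro ⟨_, ⟨k, rfl⟩, rfl⟩
        exact ⟨⟨g, hg⟩ * k, rfl⟩
    conv_lhs => rw [heq, horb, ← Set.image_inter g.injective]
    exact Set.ncard_image_of_injective _ g.injective

/-- If x and y lay in different orbits, one could place the image of `a` so as to contain x and miss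
y. Swapping x and y would give another element of S of the same rank with one point fewer in the
orbit of x. -/
theorem IsPair.isPretransitive (h : IsPair ⊤ a G) : MulAction.IsPretransitive G (Fin n) := by
  have ha := not_injective_of_not_mem_permSet h.1
  have hS := h.isSingularSemigroup
  refine ⟨fun x y => ?_⟩
  by_contra hc
  have hy : y ∉ MulAction.orbit G x := hc
  have hx : x ∈ MulAction.orbit G x := MulAction.mem_orbit_self x
  have hxy : x ≠ y := by rintro rfl; exact hy hx
  obtain ⟨w, hw⟩ := exists_notMem_range (rank_lt_of_not_injective ha)
  have hxw : a x ≠ w := fun e => hw ⟨x, e⟩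
  obtain ⟨s, hs⟩ := exists_perm_eqOn {a x, w} (fun z => if z = w then y else x) (by
    rintro u (rfl | rfl) v (rfl | rfl) <;> grind)
  have hsx : s (a x) = x := by rw [hs _ (by simp), if_neg hxw]
  have hsw : s w = y := by rw [hs _ (by simp), if_pos rfl]
  have hb : ∀ k, a * ofPerm k ∈ singularPart a G h.1 ∧ rank (a * ofPerm k) = rank a := fun k =>
    ⟨hS.mul_mem_right hS.self_mem _, (rank_mul_eq_iff _ _).2 k.injective.injOn⟩
  have hyn : ∀ z, s (a z) ≠ y := fun z e => hw ⟨z, s.injective (e.trans hsw.symm)⟩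
  have h1 := ncard_range_inter_orbit h rfl (hb s).1 (hb s).2 x
  have h2 := ncard_range_inter_orbit h rfl (hb (Equiv.swap x y * s)).1
    (hb (Equiv.swap x y * s)).2 x
  have h3 : Set.range (a * ofPerm (Equiv.swap x y * s) : Transf n) ∩ MulAction.orbit G x =
      (Set.range (a * ofPerm s : Transf n) ∩ MulAction.orbit G x) \ {x} := by
    ext z
    constructor
    · rintro ⟨⟨u, rfl⟩, hu⟩
      change Equiv.swap x y (s (a u)) ∈ _ at hu
      change Equiv.swap x y (s (a u)) ∈ _
      have hne : s (a u) ≠ x := by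
        intro e
        rw [e, Equiv.swap_apply_left] at hu
        exact hy hu
      rw [Equiv.swap_apply_of_ne_of_ne hne (hyn u)] at hu ⊢
      exact ⟨⟨⟨u, rfl⟩, hu⟩, hne⟩
    · rintro ⟨⟨⟨u, rfl⟩, hu⟩, hne⟩
      exact ⟨⟨u, Equiv.swap_apply_of_ne_of_ne hne (hyn u)⟩, hu⟩
  have hmem : x ∈ Set.range (a * ofPerm s : Transf n) ∩ MulAction.orbit G x := ⟨⟨x, hsx⟩, hx⟩
  have := Set.ncard_sdiff_singleton_lt_of_mem hmem
  rw [← h3] at this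
  omega

end Transf

/-! ### Factorization of a map through its rank. -/

namespace Transf

variable {n : ℕ}

theorem kernel_eq_iff {b c : Transf n} :
    kernel b = kernel c ↔ ∀ x y, b x = b y ↔ c x = c y := by
  rw [Set.ext_iff, Prod.forall]
  rfl

/-- The composite of a map to `Fin k` with an embedding of `Fin k`. -/
def factor {k : ℕ} (u : Fin k ↪ Fin n) (p : Fin n → Fin k) : Transf n := ⟨fun x => u (p x)⟩

section factor

variable {k : ℕ}

theorem factor_apply (u : Fin k ↪ Fin n) (p : Fin n → Fin k) (x : Fin n) :
    factor u p x = u (p x) := rfl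

theorem range_factor (u : Fin k ↪ Fin n) {p : Fin n → Fin k} (hp : Function.Surjective p) :
    Set.range (factor u p) = Set.range u := hp.range_comp u

theorem ncard_range_embedding (u : Fin k ↪ Fin n) : (Set.range u).ncard = k := by
  rw [← Set.image_univ, Set.ncard_image_of_injective _ u.injective, Set.ncard_univ,
    Nat.card_eq_fintype_card, Fintype.card_fin]

theorem rank_factor (u : Fin k ↪ Fin n) {p : Fin n → Fin k} (hp : Function.Surjective p) :
    rank (factor u p) = k := by
  rw [rank, range_factor u hp, ncard_range_embedding]

theorem factor_eq_iff (u : Fin k ↪ Fin n) (p : Fin n → Fin k) (x y : Fin n) :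
    factor u p x = factor u p y ↔ p x = p y := u.injective.eq_iff

theorem factor_perm_mem_iff {S : Subsemigroup (Transf n)} {a : Transf n}
    (hS : IsSingularSemigroup a S) (u v : Fin k ↪ Fin n) (p : Fin n → Fin k)
    (σ : Equiv.Perm (Fin k)) : factor u p ∈ S ↔ factor v (σ ∘ p) ∈ S := by
  have : ∀ x y, factor u p x = factor u p y ↔ factor v (σ ∘ p) x = factor v (σ ∘ p) y := by
    simp [factor_eq_iff]
  exact ⟨fun h => hS.mem_of_kerLe h fun x y => (this x y).1,
    fun h => hS.mem_of_kerLe h fun x y => (this x y).2⟩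

theorem exists_eq_factor {b : Transf n} (hb : rank b = k) :
    ∃ (u : Fin k ↪ Fin n) (p : Fin n → Fin k), Function.Surjective p ∧ b = factor u p := by
  have e : Set.range b ≃ Fin k := Fintype.equivFinOfCardEq (by
    rw [← Nat.card_eq_fintype_card, Nat.card_coe_set_eq]; exact hb)
  refine ⟨e.symm.toEmbedding.trans (Function.Embedding.subtype _),
    fun x => e ⟨b x, x, rfl⟩, fun i => ?_, DFunLike.ext _ _ fun x => ?_⟩
  · obtain ⟨x, hx⟩ := (e.symm i).2
    exact ⟨x, by rw [← e.eq_symm_apply]; exact Subtype.ext hx⟩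
  · simp [factor_apply]

theorem exists_eq_factor_of_kernel {f : Transf n} {p : Fin n → Fin k}
    (hp : Function.Surjective p) (h : ∀ x y, p x = p y ↔ f x = f y) :
    ∃ v : Fin k ↪ Fin n, f = factor v p := by
  obtain ⟨q, hq⟩ := hp.hasRightInverse
  have hf : ∀ x, f (q (p x)) = f x := fun x => (h _ _).1 (hq _)
  refine ⟨⟨fun i => f (q i), fun i j hij => ?_⟩, DFunLike.ext _ _ fun x => (hf x).symm⟩
  have := (h _ _).2 hij
  rwa [hq, hq] at this

theorem exists_perm_of_range_subset {u v : Fin k ↪ Fin n} (h : Set.range v ⊆ Set.range u) :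
    ∃ σ : Equiv.Perm (Fin k), ∀ i, v i = u (σ i) := by
  choose s hs using fun i => h ⟨i, rfl⟩
  have hinj : Function.Injective s := fun i j hij =>
    v.injective (by rw [← hs i, hij, hs j])
  exact ⟨Equiv.ofBijective s (Finite.injective_iff_bijective.1 hinj), fun i => (hs i).symm⟩

theorem exists_perm_factor {f : Transf n} {u : Fin k ↪ Fin n} {p : Fin n → Fin k}
    (hp : Function.Surjective p) (h : ∀ x y, p x = p y ↔ f x = f y)
    (hr : Set.range f ⊆ Set.range u) : ∃ σ : Equiv.Perm (Fin k), f = factor u (σ ∘ p) := by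
  obtain ⟨v, rfl⟩ := exists_eq_factor_of_kernel hp h
  rw [range_factor v hp] at hr
  obtain ⟨σ, hσ⟩ := exists_perm_of_range_subset hr
  exact ⟨σ, DFunLike.ext _ _ fun x => hσ (p x)⟩

end factor

/-! ### Automorphisms, maximal subgroups, principal ideals and Green's relations. -/

namespace IsSingularSemigroup

variable {a : Transf n} {S : Subsemigroup (Transf n)}

theorem mem_normalizer (hS : IsSingularSemigroup a S) (g : Equiv.Perm (Fin n)) :
    g ∈ normalizer S := by
  have key : ∀ g : Equiv.Perm (Fin n), ∀ s ∈ S, ofPerm g⁻¹ * s * ofPerm g ∈ S := fun g s hs =>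
    hS.mul_mem_right (hS.ofPerm_mul_mem hs _) _
  refine fun s => ⟨key g s, fun h => ?_⟩
  have := key g⁻¹ _ h
  rwa [← conj_mul, inv_mul_cancel, conj_one] at this

end IsSingularSemigroup

/-- Conjugation by an element of the normalizer. -/
def conjAut (S : Subsemigroup (Transf n)) : normalizer S →* MulAut S where
  toFun g :=
    { toFun := fun s => ⟨ofPerm g.1⁻¹ * s.1 * ofPerm g.1, (g.2 s.1).1 s.2⟩
      invFun := fun s => ⟨ofPerm (g.1⁻¹)⁻¹ * s.1 * ofPerm g.1⁻¹,
        ((normalizer S).inv_mem g.2 s.1).1 s.2⟩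
      left_inv := fun s => Subtype.ext <| by
        change ofPerm (g.1⁻¹)⁻¹ * (ofPerm g.1⁻¹ * s.1 * ofPerm g.1) * ofPerm g.1⁻¹ = s.1
        rw [← conj_mul, inv_mul_cancel, conj_one]
      right_inv := fun s => Subtype.ext <| by
        change ofPerm g.1⁻¹ * (ofPerm (g.1⁻¹)⁻¹ * s.1 * ofPerm g.1⁻¹) * ofPerm g.1 = s.1
        rw [← conj_mul, mul_inv_cancel, conj_one]
      map_mul' := fun s t => Subtype.ext <| DFunLike.ext _ _ fun x => by
        change g.1 (t.1 (s.1 _)) = g.1 (t.1 ((g.1)⁻¹ (g.1 (s.1 _))))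
        rw [← Equiv.Perm.mul_apply, inv_mul_cancel, Equiv.Perm.one_apply] }
  map_one' := by ext1 s; exact Subtype.ext rfl
  map_mul' g h := by ext1 s; exact Subtype.ext (conj_mul _ _ _)

theorem conjAut_apply (S : Subsemigroup (Transf n)) (g : normalizer S) (s : S) (x : Fin n) :
    (conjAut S g s : Transf n) (g.1 x) = g.1 ((s : Transf n) x) := by
  change g.1 (s.1 ((g.1)⁻¹ (g.1 x))) = _
  rw [← Equiv.Perm.mul_apply, inv_mul_cancel, Equiv.Perm.one_apply]

namespace IsSingularSemigroup

variable {a : Transf n} {S : Subsemigroup (Transf n)}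

/-- Constants are right zeros, so their images under φ are right zeros of S. A right zero t
satisfies t = const x * t, which is constant. -/
theorem exists_map_const (hS : IsSingularSemigroup a S) (φ : MulAut S) (x : Fin n) :
    ∃ y, φ ⟨const x, hS.const_mem x⟩ = ⟨const y, hS.const_mem y⟩ := by
  refine ⟨(φ ⟨const x, hS.const_mem x⟩ : Transf n) x, ?_⟩
  have h : (φ.symm ⟨const x, hS.const_mem x⟩) * ⟨const x, hS.const_mem x⟩ =
      (⟨const x, hS.const_mem x⟩ : S) := Subtype.ext rfl
  have h2 := congrArg φ h
  rw [map_mul, MulEquiv.apply_symm_apply] at h2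
  rw [← h2]
  rfl

/-- An automorphism φ permutes the constants through some g. Applying φ to const x * s = const (s x)
shows that φ s sends g x to g (s x), so φ is conjugation by g. -/
theorem conjAut_bijective (hS : IsSingularSemigroup a S) : Function.Bijective (conjAut S) := by
  constructor
  · intro g h hgh
    refine Subtype.ext (Equiv.ext fun x => ?_)
    have hg := conjAut_apply S g ⟨const x, hS.const_mem x⟩ x
    rw [hgh] at hg
    have hc : ∀ z, (conjAut S h ⟨const x, hS.const_mem x⟩ : Transf n) z = h.1 x := fun _ => rfl
    exact hg.symm.trans (hc _)
  · intro φ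
    choose g hg using hS.exists_map_const φ
    have hinj : Function.Injective g := fun x y hxy => by
      have h1 : φ ⟨const x, hS.const_mem x⟩ = φ ⟨const y, hS.const_mem y⟩ := by
        rw [hg, hg]; exact Subtype.ext (by rw [hxy])
      exact DFunLike.congr_fun (Subtype.ext_iff.1 (φ.injective h1)) x
    let e : Equiv.Perm (Fin n) := Equiv.ofBijective g (Finite.injective_iff_bijective.1 hinj)
    refine ⟨⟨e, hS.mem_normalizer e⟩, ?_⟩
    ext1 s
    refine Subtype.ext (DFunLike.ext _ _ fun z => ?_)
    obtain ⟨x, rfl⟩ := e.surjective z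
    rw [conjAut_apply S ⟨e, hS.mem_normalizer e⟩ s x]
    have h1 : (⟨const x, hS.const_mem x⟩ : S) * s = ⟨const (s.1 x), hS.const_mem _⟩ :=
      Subtype.ext rfl
    have h2 := congrArg φ h1
    rw [map_mul, hg, hg] at h2
    exact (DFunLike.congr_fun (Subtype.ext_iff.1 h2) (e x)).symm

theorem exists_mulEquiv_normalizer (hS : IsSingularSemigroup a S) :
    ∃ Φ : MulAut S ≃* normalizer S, ∀ (φ : MulAut S) (s : S),
      ((φ s : S) : Transf n) =
        ofPerm (Φ φ : Equiv.Perm (Fin n))⁻¹ * (s : Transf n) * ofPerm (Φ φ : Equiv.Perm (Fin n)) := by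
  refine ⟨(MulEquiv.ofBijective _ hS.conjAut_bijective).symm, fun φ s => ?_⟩
  obtain ⟨g, rfl⟩ := hS.conjAut_bijective.2 φ
  have : (MulEquiv.ofBijective _ hS.conjAut_bijective).symm (conjAut S g) = g :=
    (MulEquiv.ofBijective _ hS.conjAut_bijective).symm_apply_apply g
  rw [this]
  rfl

theorem nonempty_mulAut_equiv (hS : IsSingularSemigroup a S) :
    Nonempty (MulAut S ≃* Equiv.Perm (Fin n)) := by
  have h : normalizer S = ⊤ := eq_top_iff.2 fun g _ => hS.mem_normalizer g
  exact ⟨(MulEquiv.ofBijective _ hS.conjAut_bijective).symm.trans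
    ((MulEquiv.subgroupCongr h).trans Subgroup.topEquiv)⟩

/-- Write e as a surjection p followed by an embedding u. Idempotency says that p inverts u, so the
maps with a permutation inserted between p and u multiply like those permutations. -/
theorem exists_maximal_subgroup (hS : IsSingularSemigroup a S) {e : Transf n} (he : e ∈ S)
    (hee : e * e = e) : ∃ H : Subsemigroup (Transf n),
      (H : Set (Transf n)) = {f | f ∈ S ∧ kernel f = kernel e ∧ Set.range f = Set.range e} ∧
      Nonempty (H ≃* Equiv.Perm (Fin (rank e))) := by
  obtain ⟨u, p, hp, hup⟩ := exists_eq_factor (b := e) rfl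
  have hpu : ∀ i, p (u i) = i := fun i => by
    obtain ⟨x, rfl⟩ := hp i
    rw [hup] at hee
    exact u.injective (DFunLike.congr_fun hee x)
  have hmul : ∀ σ τ : Equiv.Perm (Fin (rank e)),
      factor u (σ ∘ p) * factor u (τ ∘ p) = factor u ((τ * σ : Equiv.Perm _) ∘ p) := fun σ τ =>
    DFunLike.ext _ _ fun x => congrArg (fun i => u (τ i)) (hpu _)
  have hmem : ∀ f, (f ∈ S ∧ kernel f = kernel e ∧ Set.range f = Set.range e) ↔
      ∃ σ : Equiv.Perm (Fin (rank e)), f = factor u (σ ∘ p) := by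
    intro f
    rw [kernel_eq_iff]
    constructor
    · rintro ⟨-, hk, hr⟩
      refine exists_perm_factor hp (fun x y => ?_) ?_
      · rw [hk]
        conv_rhs => rw [hup]
        exact (factor_eq_iff u p x y).symm
      · rw [hr]
        conv_lhs => rw [hup]
        exact (range_factor u hp).le
    · rintro ⟨σ, rfl⟩
      refine ⟨(factor_perm_mem_iff hS u u p σ).1 (hup ▸ he), fun x y => ?_, ?_⟩
      · conv_rhs => rw [hup]
        simp [factor_eq_iff]
      · conv_rhs => rw [hup]
        rw [range_factor u hp, range_factor u (σ.surjective.comp hp)]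
  let H : Subsemigroup (Transf n) :=
    { carrier := {f | f ∈ S ∧ kernel f = kernel e ∧ Set.range f = Set.range e}
      mul_mem' := by
        intro f g hf hg
        obtain ⟨σ, rfl⟩ := (hmem f).1 hf
        obtain ⟨τ, rfl⟩ := (hmem g).1 hg
        exact (hmem _).2 ⟨_, hmul σ τ⟩ }
  -- The inverse compensates for the reversed order of composition in `Equiv.Perm`.
  let θ : Equiv.Perm (Fin (rank e)) →ₙ* H :=
    { toFun := fun σ => ⟨factor u ((σ⁻¹ : Equiv.Perm _) ∘ p), (hmem _).2 ⟨_, rfl⟩⟩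
      map_mul' := fun σ τ => Subtype.ext <| by
        change _ = factor u _ * factor u _
        rw [hmul, mul_inv_rev] }
  refine ⟨H, rfl, ⟨(MulEquiv.ofBijective θ ⟨fun σ τ hστ => ?_, fun f => ?_⟩).symm⟩⟩
  · refine inv_injective (Equiv.ext fun i => ?_)
    obtain ⟨x, rfl⟩ := hp i
    exact u.injective (DFunLike.congr_fun (Subtype.ext_iff.1 hστ) x)
  · obtain ⟨σ, hσ⟩ := (hmem f).1 f.2
    refine ⟨σ⁻¹, Subtype.ext ?_⟩
    change factor u ((σ⁻¹⁻¹ : Equiv.Perm _) ∘ p) = f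
    rw [inv_inv, hσ]

/-- Embedding the image of c into that of b gives an intermediate map with the kernel of c and image
inside that of b; it is a left multiple of b, and c is a right multiple of it. -/
theorem exists_eq_mul_mul (hS : IsSingularSemigroup a S) {b c : Transf n}
    (hb : b ∈ S) (hc : c ∈ S) (h : rank c ≤ rank b) : ∃ s ∈ S, ∃ t ∈ S, c = s * b * t := by
  obtain ⟨j, hj, hm⟩ := exists_injOn_mapsTo (A := Set.range c) (B := Set.range b) h
  have hk : ∀ x y, (c * ⟨j⟩ : Transf n) x = (c * ⟨j⟩ : Transf n) y ↔ c x = c y := fun x y =>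
    ⟨fun e => hj ⟨x, rfl⟩ ⟨y, rfl⟩ e, fun e => congrArg j e⟩
  have hd := hS.mul_mem_right hc ⟨j⟩
  obtain ⟨s, hs, hsd⟩ := hS.exists_eq_mul_of_range_subset hb hd (by
    rintro _ ⟨x, rfl⟩; exact hm _ ⟨x, rfl⟩)
  obtain ⟨t, ht, htd⟩ := hS.exists_eq_mul_of_kerLe hd hc fun x y => (hk x y).1
  exact ⟨s, hs, t, ht, by rw [← hsd, ← htd]⟩

theorem right_ideal_eq (hS : IsSingularSemigroup a S) {b : Transf n} (hb : b ∈ S) :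
    {b} * (S : Set (Transf n)) = {c | c ∈ S ∧ KerLe b c} := by
  ext c
  simp only [Set.singleton_mul, Set.mem_image, SetLike.mem_coe, Set.mem_ofPred_eq]
  constructor
  · rintro ⟨t, ht, rfl⟩
    exact ⟨S.mul_mem hb ht, fun _ _ h => congrArg t h⟩
  · rintro ⟨hc, h⟩
    obtain ⟨t, ht, rfl⟩ := hS.exists_eq_mul_of_kerLe hb hc h
    exact ⟨t, ht, rfl⟩

theorem left_ideal_eq (hS : IsSingularSemigroup a S) {b : Transf n} (hb : b ∈ S) :
    (S : Set (Transf n)) * {b} = {c | c ∈ S ∧ Set.range c ⊆ Set.range b} := by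
  ext c
  simp only [Set.mul_singleton, Set.mem_image, SetLike.mem_coe, Set.mem_ofPred_eq]
  constructor
  · rintro ⟨s, hs, rfl⟩
    exact ⟨S.mul_mem hs hb, by rintro _ ⟨x, rfl⟩; exact ⟨s x, rfl⟩⟩
  · rintro ⟨hc, h⟩
    obtain ⟨s, hs, rfl⟩ := hS.exists_eq_mul_of_range_subset hb hc h
    exact ⟨s, hs, rfl⟩

theorem ideal_eq (hS : IsSingularSemigroup a S) {b : Transf n} (hb : b ∈ S) :
    (S : Set (Transf n)) * {b} * (S : Set (Transf n)) = {c | c ∈ S ∧ rank c ≤ rank b} := by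
  ext c
  simp only [Set.mem_mul, Set.mul_singleton, Set.mem_image, SetLike.mem_coe, Set.mem_ofPred_eq]
  constructor
  · rintro ⟨_, ⟨s, hs, rfl⟩, t, ht, rfl⟩
    exact ⟨S.mul_mem (S.mul_mem hs hb) ht, (rank_mul_le_left _ _).trans (rank_mul_le_right _ _)⟩
  · rintro ⟨hc, h⟩
    obtain ⟨s, hs, t, ht, rfl⟩ := hS.exists_eq_mul_mul hb hc h
    exact ⟨_, ⟨s, hs, rfl⟩, t, ht, rfl⟩

theorem right_ideal_eq_iff (hS : IsSingularSemigroup a S) {b c : Transf n} (hb : b ∈ S)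
    (hc : c ∈ S) : {b} * (S : Set (Transf n)) = {c} * (S : Set (Transf n)) ↔
      kernel b = kernel c := by
  rw [hS.right_ideal_eq hb, hS.right_ideal_eq hc, kernel_eq_iff]
  constructor
  · intro h x y
    have h1 := (Set.ext_iff.1 h b).1 ⟨hb, fun _ _ h => h⟩
    have h2 := (Set.ext_iff.1 h c).2 ⟨hc, fun _ _ h => h⟩
    exact ⟨h2.2 x y, h1.2 x y⟩
  · intro h
    ext d
    simp only [Set.mem_ofPred_eq, KerLe, h]

theorem left_ideal_eq_iff (hS : IsSingularSemigroup a S) {b c : Transf n} (hb : b ∈ S)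
    (hc : c ∈ S) : (S : Set (Transf n)) * {b} = (S : Set (Transf n)) * {c} ↔
      Set.range b = Set.range c := by
  rw [hS.left_ideal_eq hb, hS.left_ideal_eq hc]
  refine ⟨fun h => subset_antisymm ?_ ?_, fun h => by rw [h]⟩
  · exact ((Set.ext_iff.1 h b).1 ⟨hb, subset_rfl⟩).2
  · exact ((Set.ext_iff.1 h c).2 ⟨hc, subset_rfl⟩).2

theorem ideal_eq_iff (hS : IsSingularSemigroup a S) {b c : Transf n} (hb : b ∈ S)
    (hc : c ∈ S) : (S : Set (Transf n)) * {b} * (S : Set (Transf n)) =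
      (S : Set (Transf n)) * {c} * (S : Set (Transf n)) ↔ rank b = rank c := by
  rw [hS.ideal_eq hb, hS.ideal_eq hc]
  refine ⟨fun h => le_antisymm ?_ ?_, fun h => by rw [h]⟩
  · exact ((Set.ext_iff.1 h b).1 ⟨hb, le_rfl⟩).2
  · exact ((Set.ext_iff.1 h c).2 ⟨hc, le_rfl⟩).2

theorem greenR_iff (hS : IsSingularSemigroup a S) {b c : Transf n} (hb : b ∈ S)
    (hc : c ∈ S) : GreenR S b c ↔ kernel b = kernel c := by
  rw [← hS.right_ideal_eq_iff hb hc, GreenR, Set.union_eq_right.2, Set.union_eq_right.2]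
  · rw [hS.right_ideal_eq hc]
    exact Set.singleton_subset_iff.2 ⟨hc, fun _ _ h => h⟩
  · rw [hS.right_ideal_eq hb]
    exact Set.singleton_subset_iff.2 ⟨hb, fun _ _ h => h⟩

theorem greenL_iff (hS : IsSingularSemigroup a S) {b c : Transf n} (hb : b ∈ S)
    (hc : c ∈ S) : GreenL S b c ↔ Set.range b = Set.range c := by
  rw [← hS.left_ideal_eq_iff hb hc, GreenL, Set.union_eq_right.2, Set.union_eq_right.2]
  · rw [hS.left_ideal_eq hc]
    exact Set.singleton_subset_iff.2 ⟨hc, subset_rfl⟩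
  · rw [hS.left_ideal_eq hb]
    exact Set.singleton_subset_iff.2 ⟨hb, subset_rfl⟩

theorem principalIdeal_eq (hS : IsSingularSemigroup a S) {b : Transf n} (hb : b ∈ S) :
    principalIdeal S b = (S : Set (Transf n)) * {b} * (S : Set (Transf n)) := by
  refine Set.union_eq_right.2 ?_
  rw [hS.ideal_eq hb, hS.left_ideal_eq hb, hS.right_ideal_eq hb]
  rintro c ((rfl | ⟨hc, h⟩) | ⟨hc, h⟩)
  · exact ⟨hb, le_rfl⟩
  · exact ⟨hc, h.rank_le⟩
  · exact ⟨hc, Set.ncard_le_ncard h⟩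

theorem greenJ_iff (hS : IsSingularSemigroup a S) {b c : Transf n} (hb : b ∈ S)
    (hc : c ∈ S) : GreenJ S b c ↔ rank b = rank c := by
  rw [GreenJ, hS.principalIdeal_eq hb, hS.principalIdeal_eq hc, hS.ideal_eq_iff hb hc]

end IsSingularSemigroup

end Transf

/-! ### The listed relations are congruences. -/

namespace Transf

variable {n : ℕ}

theorem exists_con {S : Subsemigroup (Transf n)} {R : S → S → Prop} (hR : Equivalence R)
    (hl : ∀ s f g : S, R f g → R (s * f) (s * g)) (hr : ∀ s f g : S, R f g → R (f * s) (g * s)) :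
    ∃ c : Con S, ∀ f g : S, c f g ↔ R f g :=
  ⟨{ r := R, iseqv := hR, mul' := fun {_ x y _} h h' => hR.trans (hr y _ _ h) (hl x _ _ h') },
    fun _ _ => Iff.rfl⟩

theorem ofPerm_mul_rank (g : Equiv.Perm (Fin n)) (b : Transf n) :
    rank (ofPerm g * b) = rank b := by
  refine le_antisymm (rank_mul_le_right _ _) ?_
  conv_lhs => rw [← ofPerm_inv_mul_cancel g b]
  exact rank_mul_le_right _ _

section factor

variable {k : ℕ}

theorem rank_factor_lt (u : Fin k ↪ Fin n) {p : Fin n → Fin k} (hp : ¬ Function.Surjective p) :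
    rank (factor u p) < k := by
  have h : Set.range (factor u p) = u '' Set.range p := Set.range_comp u p
  rw [rank, h, Set.ncard_image_of_injective _ u.injective]
  have h2 : Set.range p ⊂ Set.univ :=
    Set.ssubset_univ_iff.2 fun e => hp (Set.range_eq_univ.1 e)
  have := Set.ncard_lt_ncard h2
  rwa [Set.ncard_univ, Nat.card_eq_fintype_card, Fintype.card_fin] at this

theorem exists_perm_comp {p q : Fin n → Fin k} (hp : Function.Surjective p)
    (hq : Function.Surjective q) (h : ∀ x y, p x = p y ↔ q x = q y) :
    ∃ τ : Equiv.Perm (Fin k), q = τ ∘ p := by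
  obtain ⟨s, hs⟩ := hp.hasRightInverse
  have hc : ∀ x, q (s (p x)) = q x := fun x => (h _ _).1 (hs _)
  have hsurj : Function.Surjective fun i => q (s i) := fun j => by
    obtain ⟨x, rfl⟩ := hq j
    exact ⟨p x, hc x⟩
  exact ⟨Equiv.ofBijective _ (Finite.surjective_iff_bijective.1 hsurj), funext fun x => (hc x).symm⟩

variable {N : Subgroup (Equiv.Perm (Fin k))}

/-- Maps of rank `k` with the same kernel and image that differ by a permutation in `N`. -/
def PermRel (N : Subgroup (Equiv.Perm (Fin k))) (f g : Transf n) : Prop :=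
  ∃ (p : Fin n → Fin k) (u : Fin k ↪ Fin n), Function.Surjective p ∧ ∃ σ ∈ N,
    f = factor u p ∧ g = factor u (σ ∘ p)

theorem malcevRel_iff {f g : Transf n} :
    malcevRel k N f g ↔ f = g ∨ (rank f < k ∧ rank g < k) ∨ PermRel N f g := by
  have : ∀ (p : Fin n → Fin k) (u : Fin k ↪ Fin n) (σ : Equiv.Perm (Fin k)),
      ((∀ x, f x = u (p x)) ∧ ∀ x, g x = u (σ (p x))) ↔
        (f = factor u p ∧ g = factor u (σ ∘ p)) := fun p u σ => by
    rw [DFunLike.ext_iff, DFunLike.ext_iff]; rfl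
  simp only [malcevRel, PermRel, this]

theorem PermRel.rank_eq {f g : Transf n} (h : PermRel N f g) : rank f = k ∧ rank g = k := by
  obtain ⟨p, u, hp, σ, -, rfl, rfl⟩ := h
  exact ⟨rank_factor u hp, rank_factor u (σ.surjective.comp hp)⟩

theorem PermRel.symm {f g : Transf n} (h : PermRel N f g) : PermRel N g f := by
  obtain ⟨p, u, hp, σ, hσ, rfl, rfl⟩ := h
  refine ⟨σ ∘ p, u, σ.surjective.comp hp, σ⁻¹, N.inv_mem hσ, rfl, DFunLike.ext _ _ fun x => ?_⟩
  exact congrArg u (σ.symm_apply_apply _).symm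

/-- The two pairs may use different numberings of the kernel classes. Changing from one to the other
conjugates the second permutation, which is where normality is needed. -/
theorem PermRel.trans (hN : N.Normal) {f g h : Transf n} (h1 : PermRel N f g)
    (h2 : PermRel N g h) : PermRel N f h := by
  obtain ⟨p, u, hp, σ, hσ, rfl, rfl⟩ := h1
  obtain ⟨q, v, hq, ρ, hρ, hg, rfl⟩ := h2
  obtain ⟨τ, rfl⟩ := exists_perm_comp hp hq fun x y => by
    rw [← factor_eq_iff v q, ← hg, factor_eq_iff]; simp
  have huv : ∀ i, u (σ i) = v (τ i) := fun i => by
    obtain ⟨x, rfl⟩ := hp i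
    exact DFunLike.congr_fun hg x
  refine ⟨p, u, hp, σ * (τ⁻¹ * ρ * τ), N.mul_mem hσ ?_, rfl, DFunLike.ext _ _ fun x => ?_⟩
  · simpa using hN.conj_mem ρ hρ τ⁻¹
  · change v (ρ (τ (p x))) = u (σ (τ⁻¹ (ρ (τ (p x)))))
    rw [huv, ← Equiv.Perm.mul_apply τ, mul_inv_cancel, Equiv.Perm.one_apply]

theorem malcevRel_equivalence (hN : N.Normal) :
    Equivalence (malcevRel (n := n) k N) where
  refl f := Or.inl rfl
  symm {f g} h := by
    rw [malcevRel_iff] at h ⊢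
    rcases h with h | h | h
    · exact Or.inl h.symm
    · exact Or.inr (Or.inl h.symm)
    · exact Or.inr (Or.inr h.symm)
  trans {f g h} h1 h2 := by
    rw [malcevRel_iff] at h1 h2 ⊢
    rcases h1 with rfl | h1 | h1
    · exact h2
    · rcases h2 with rfl | h2 | h2
      · exact Or.inr (Or.inl h1)
      · exact Or.inr (Or.inl ⟨h1.1, h2.2⟩)
      · exact absurd h2.rank_eq.1 h1.2.ne
    · rcases h2 with rfl | h2 | h2
      · exact Or.inr (Or.inr h1)
      · exact absurd h1.rank_eq.2 h2.1.ne
      · exact Or.inr (Or.inr (h1.trans hN h2))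

theorem malcevRel_mul_left (s : Transf n) {f g : Transf n} (h : malcevRel k N f g) :
    malcevRel k N (s * f) (s * g) := by
  rw [malcevRel_iff] at h ⊢
  rcases h with rfl | h | ⟨p, u, hp, σ, hσ, rfl, rfl⟩
  · exact Or.inl rfl
  · exact Or.inr (Or.inl ⟨(rank_mul_le_right _ _).trans_lt h.1, (rank_mul_le_right _ _).trans_lt h.2⟩)
  · by_cases hs : Function.Surjective (p ∘ s)
    · exact Or.inr (Or.inr ⟨p ∘ s, u, hs, σ, hσ, rfl, rfl⟩)
    · refine Or.inr (Or.inl ⟨rank_factor_lt u hs, rank_factor_lt u (p := σ ∘ p ∘ s) fun h => hs ?_⟩)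
      exact (σ.comp_surjective _).1 h

theorem malcevRel_mul_right (s : Transf n) {f g : Transf n} (h : malcevRel k N f g) :
    malcevRel k N (f * s) (g * s) := by
  rw [malcevRel_iff] at h ⊢
  rcases h with rfl | h | ⟨p, u, hp, σ, hσ, rfl, rfl⟩
  · exact Or.inl rfl
  · exact Or.inr (Or.inl ⟨(rank_mul_le_left _ _).trans_lt h.1, (rank_mul_le_left _ _).trans_lt h.2⟩)
  · by_cases hs : Set.InjOn s (Set.range u)
    · exact Or.inr (Or.inr ⟨p, ⟨s ∘ u, fun i j h => u.injective (hs ⟨i, rfl⟩ ⟨j, rfl⟩ h)⟩, hp, σ, hσ,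
        rfl, rfl⟩)
    · have key : ∀ q : Fin n → Fin k, Function.Surjective q → rank (factor u q * s) < k := by
        intro q hq
        have h1 := rank_mul_le_left (factor u q) s
        have h2 := mt (rank_mul_eq_iff (factor u q) s).1 (by rwa [range_factor u hq])
        rw [rank_factor u hq] at h1 h2
        omega
      exact Or.inr (Or.inl ⟨key p hp, key _ (σ.surjective.comp hp)⟩)

end factor

variable {a : Transf n} {S : Subsemigroup (Transf n)}

theorem eq_or_of_fibre_two (h2 : ∀ x : Fin n, {y : Fin n | a y = a x}.ncard = 2) {x y z : Fin n}
    (hxy : a x = a y) (hxz : a x = a z) : x = y ∨ x = z ∨ y = z := by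
  by_contra hc
  push Not at hc
  have hsub : ({x, y, z} : Set (Fin n)) ⊆ {w | a w = a x} := by
    rintro w (rfl | rfl | rfl)
    · rfl
    · exact hxy.symm
    · exact hxz.symm
  have := Set.ncard_le_ncard hsub
  rw [h2 x, Set.ncard_eq_three.2 ⟨x, y, z, hc.1, hc.2.1, hc.2.2, rfl⟩] at this
  omega

namespace IsSingularSemigroup

/-- Such an s has rank r, so its kernel is a translate of ker(a) and A is a transversal of it. As
all classes have two points, the complement is a transversal too. -/
theorem injOn_compl (hS : IsSingularSemigroup a S)
    (h2 : ∀ x : Fin n, {y : Fin n | a y = a x}.ncard = 2) {s : Transf n} (hs : s ∈ S)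
    {A : Set (Fin n)} (hA : A.ncard = rank a) (hi : Set.InjOn s A) : Set.InjOn s Aᶜ := by
  have hr := hS.rank_le hs
  have himg : s '' A = Set.range s :=
    Set.eq_of_subset_of_ncard_le (Set.image_subset_range _ _) (by
      rw [Set.InjOn.ncard_image hi, hA]; exact hr)
  have hrank : rank s = rank a := by
    rw [← hA, ← Set.InjOn.ncard_image hi, himg, rank]
  obtain ⟨g, hg⟩ := (hS s).1 hs
  have hk : ∀ x y, s x = s y → a (g⁻¹ x) = a (g⁻¹ y) := fun x y hxy =>
    (hg.ker_eq (by rw [ofPerm_mul_rank, hrank]) _ _).2 (by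
      simpa [mul_apply, ofPerm_apply] using hxy)
  intro x hx y hy hxy
  obtain ⟨z, hz, hzx⟩ : s x ∈ s '' A := by rw [himg]; exact ⟨x, rfl⟩
  rcases eq_or_of_fibre_two h2 (hk x y hxy) (hk x z hzx.symm) with h | h | h
  · exact g⁻¹.injective h
  · exact absurd hz ((g⁻¹.injective h) ▸ hx)
  · exact absurd hz ((g⁻¹.injective h) ▸ hy)

end IsSingularSemigroup

variable {P : Set (Set (Fin n))}

theorem complementRel_equivalence {r : ℕ} (hP : ∀ A ∈ P, Aᶜ ∈ P) :
    Equivalence (complementRel (n := n) r P) where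
  refl f := Or.inl rfl
  symm {f g} h := by
    rcases h with h | h | ⟨h1, h2, h3, h4⟩
    · exact Or.inl h.symm
    · exact Or.inr (Or.inl h.symm)
    · refine Or.inr (Or.inr ⟨h2, h1, h3.symm, ?_⟩)
      rcases h4 with h4 | ⟨h4, h5⟩
      · exact Or.inl h4.symm
      · exact Or.inr ⟨h5 ▸ hP _ h4, by rw [h5, compl_compl]⟩
  trans {f g h} h1 h2 := by
    rcases h1 with rfl | h1 | ⟨h1, h1', h1k, h1r⟩
    · exact h2
    · rcases h2 with rfl | h2 | ⟨h2, -⟩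
      · exact Or.inr (Or.inl h1)
      · exact Or.inr (Or.inl ⟨h1.1, h2.2⟩)
      · exact absurd h2 h1.2.ne
    · rcases h2 with rfl | h2 | ⟨h2, h2', h2k, h2r⟩
      · exact Or.inr (Or.inr ⟨h1, h1', h1k, h1r⟩)
      · exact absurd h1' h2.1.ne
      · refine Or.inr (Or.inr ⟨h1, h2', h1k.trans h2k, ?_⟩)
        rcases h1r with h1r | ⟨h1r, h1c⟩
        · rw [h1r]; exact h2r
        · rcases h2r with h2r | ⟨h2r, h2c⟩
          · exact Or.inr ⟨h1r, h2r ▸ h1c⟩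
          · exact Or.inl (by rw [h2c, h1c, compl_compl])

theorem rank_eq_of_kernel_eq {b c : Transf n} (h : kernel b = kernel c) : rank b = rank c :=
  le_antisymm (KerLe.rank_le fun x y => (kernel_eq_iff.1 h x y).2)
    (KerLe.rank_le fun x y => (kernel_eq_iff.1 h x y).1)

theorem range_mul_eq_of_rank {s f : Transf n} (h : rank (s * f) = rank f) :
    Set.range (s * f : Transf n) = Set.range f :=
  Set.eq_of_subset_of_ncard_le (by rintro _ ⟨x, rfl⟩; exact ⟨s x, rfl⟩) h.ge

theorem complementRel_mul_left {r : ℕ} (s : Transf n) {f g : Transf n}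
    (h : complementRel r P f g) : complementRel r P (s * f) (s * g) := by
  rcases h with rfl | h | ⟨h1, h2, h3, h4⟩
  · exact Or.inl rfl
  · exact Or.inr (Or.inl ⟨(rank_mul_le_right _ _).trans_lt h.1, (rank_mul_le_right _ _).trans_lt h.2⟩)
  · have hk : kernel (s * f) = kernel (s * g) :=
      kernel_eq_iff.2 fun x y => kernel_eq_iff.1 h3 (s x) (s y)
    have hr := rank_eq_of_kernel_eq hk
    have hle := rank_mul_le_right s f
    rcases lt_or_eq_of_le hle with hlt | heq
    · exact Or.inr (Or.inl (by omega))
    · refine Or.inr (Or.inr ⟨heq.trans h1, by omega, hk, ?_⟩)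
      rw [range_mul_eq_of_rank heq, range_mul_eq_of_rank (by omega)]
      exact h4

/-- By `injOn_compl`, s lowers the rank of both maps or of neither. In the second case both products
have the whole image of s as their image. -/
theorem complementRel_mul_right (hS : IsSingularSemigroup a S)
    (h2 : ∀ x : Fin n, {y : Fin n | a y = a x}.ncard = 2) {s : Transf n} (hs : s ∈ S)
    {f g : Transf n} (h : complementRel (rank a) P f g) :
    complementRel (rank a) P (f * s) (g * s) := by
  rcases h with rfl | h | ⟨hf, hg, hk, hr⟩
  · exact Or.inl rfl
  · exact Or.inr (Or.inl ⟨(rank_mul_le_left _ _).trans_lt h.1, (rank_mul_le_left _ _).trans_lt h.2⟩)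
  · have hiff : Set.InjOn s (Set.range f) ↔ Set.InjOn s (Set.range g) := by
      rcases hr with hr | ⟨-, hr⟩
      · rw [hr]
      · refine ⟨fun hi => ?_, fun hi => ?_⟩
        · rw [hr]; exact hS.injOn_compl h2 hs hf hi
        · rw [← compl_compl (Set.range f), ← hr]; exact hS.injOn_compl h2 hs hg hi
    rw [← rank_mul_eq_iff, ← rank_mul_eq_iff, hf, hg] at hiff
    have h1 := rank_mul_le_left f s
    have h2 := rank_mul_le_left g s
    by_cases hfs : rank (f * s) = rank a
    · have hgs := hiff.1 hfs
      have hsr := hS.rank_le hs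
      have h3 := rank_mul_le_right f s
      refine Or.inr (Or.inr ⟨hfs, hgs, ?_, Or.inl ?_⟩)
      · rw [kernel_eq_iff] at hk ⊢
        have hif := (rank_mul_eq_iff f s).1 (hfs.trans hf.symm)
        have hig := (rank_mul_eq_iff g s).1 (hgs.trans hg.symm)
        intro x y
        rw [mul_apply, mul_apply, mul_apply, mul_apply, hif.eq_iff ⟨x, rfl⟩ ⟨y, rfl⟩,
          hig.eq_iff ⟨x, rfl⟩ ⟨y, rfl⟩]
        exact hk x y
      · rw [range_mul_eq_of_rank (by omega), range_mul_eq_of_rank (by omega)]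
    · have hgs := mt hiff.2 hfs
      exact Or.inr (Or.inl (by omega))

theorem eq_const_of_rank_le_one {f : Transf n} (h : rank f ≤ 1) (x : Fin n) : f = const (f x) :=
  DFunLike.ext _ _ fun y => (Set.ncard_le_one).1 h _ ⟨y, rfl⟩ _ ⟨x, rfl⟩

end Transf

/-! ### How related pairs collapse ranks in an arbitrary congruence. -/

namespace Transf

variable {n : ℕ} {a : Transf n} {S : Subsemigroup (Transf n)}

/-- A congruence of the subsemigroup `S`, as a relation on all transformations. -/
structure IsCongruence (S : Subsemigroup (Transf n)) (R : Transf n → Transf n → Prop) : Prop where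
  mem_left : ∀ {f g}, R f g → f ∈ S
  refl : ∀ {f}, f ∈ S → R f f
  symm : ∀ {f g}, R f g → R g f
  trans : ∀ {f g h}, R f g → R g h → R f h
  mul_left : ∀ {s f g}, s ∈ S → R f g → R (s * f) (s * g)
  mul_right : ∀ {s f g}, s ∈ S → R f g → R (f * s) (g * s)

theorem isCongruence_of_con (c : Con S) :
    IsCongruence S fun f g => ∃ (hf : f ∈ S) (hg : g ∈ S), c ⟨f, hf⟩ ⟨g, hg⟩ where
  mem_left := fun ⟨hf, _⟩ => hf
  refl hf := ⟨hf, hf, c.refl _⟩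
  symm := fun ⟨hf, hg, h⟩ => ⟨hg, hf, c.symm h⟩
  trans := fun ⟨hf, _, h⟩ ⟨_, hg, h'⟩ => ⟨hf, hg, c.trans h h'⟩
  mul_left := fun hs ⟨hf, hg, h⟩ => ⟨S.mul_mem hs hf, S.mul_mem hs hg, c.mul (c.refl ⟨_, hs⟩) h⟩
  mul_right := fun hs ⟨hf, hg, h⟩ => ⟨S.mul_mem hf hs, S.mul_mem hg hs, c.mul h (c.refl ⟨_, hs⟩)⟩

/-- All the elements of `S` of rank at most `m` are related. -/
def Collapsed (S : Subsemigroup (Transf n)) (R : Transf n → Transf n → Prop) (m : ℕ) : Prop :=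
  ∀ f ∈ S, ∀ g ∈ S, rank f ≤ m → rank g ≤ m → R f g

theorem Collapsed.mono {R : Transf n → Transf n → Prop} {m m' : ℕ} (h : Collapsed S R m)
    (hm : m' ≤ m) : Collapsed S R m' := fun f hf g hg hf' hg' =>
  h f hf g hg (hf'.trans hm) (hg'.trans hm)

theorem exists_apply_eq_of_rank_lt {f h : Transf n} (hlt : rank h < rank f) :
    ∃ x y, h x = h y ∧ f x ≠ f y := by
  by_contra hc
  push Not at hc
  exact absurd (KerLe.rank_le (a := h) (b := f) hc) (by omega)

theorem rank_mul_lt {f s : Transf n} {p q : Fin n} (hp : p ∈ Set.range f) (hq : q ∈ Set.range f)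
    (hpq : p ≠ q) (h : s p = s q) : rank (f * s) < rank f :=
  lt_of_le_of_ne (rank_mul_le_left _ _) fun e => hpq ((rank_mul_eq_iff f s).1 e hp hq h)

/-- A section of `f` along a permutation of its image that takes prescribed values at two points
of the image. -/
theorem exists_twisted_section {f : Transf n} {p q x y : Fin n} (hp : p ∈ Set.range f)
    (hq : q ∈ Set.range f) (hpq : p ≠ q) (hxy : f x ≠ f y) :
    ∃ j : Fin n → Fin n, j p = x ∧ j q = y ∧ Set.InjOn (fun v => f (j v)) (Set.range f) := by
  classical
  have : Nonempty (Fin n) := ⟨x⟩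
  let σ : Equiv.Perm (Fin n) := Equiv.swap p (f x)
  let π : Equiv.Perm (Fin n) := Equiv.swap (σ q) (f y) * σ
  have hσ : ∀ v ∈ Set.range f, σ v ∈ Set.range f := fun v hv => by
    have : f x ∈ Set.range f := ⟨x, rfl⟩
    simp only [σ, Equiv.swap_apply_def]
    split_ifs <;> assumption
  have hπ : ∀ v ∈ Set.range f, π v ∈ Set.range f := fun v hv => by
    have h1 : f y ∈ Set.range f := ⟨y, rfl⟩
    have h2 := hσ v hv
    have h3 := hσ q hq
    simp only [π, Equiv.Perm.mul_apply, Equiv.swap_apply_def (σ q)]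
    split_ifs <;> assumption
  have hσp : σ p = f x := Equiv.swap_apply_left _ _
  have hπp : π p = f x := by
    have h1 : f x ≠ σ q := fun e => hpq (σ.injective (hσp.trans e))
    rw [Equiv.Perm.mul_apply, hσp, Equiv.swap_apply_of_ne_of_ne h1 hxy]
  have hπq : π q = f y := Equiv.swap_apply_left _ _
  let j : Fin n → Fin n := fun v => if v = p then x else if v = q then y else Function.invFun f (π v)
  have hjp : j p = x := if_pos rfl
  have hjq : j q = y := (if_neg hpq.symm).trans (if_pos rfl)
  have hj : ∀ v ∈ Set.range f, f (j v) = π v := fun v hv => by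
    by_cases h1 : v = p
    · rw [h1, hjp, hπp]
    · by_cases h2 : v = q
      · rw [h2, hjq, hπq]
      · have : j v = Function.invFun f (π v) := (if_neg h1).trans (if_neg h2)
        rw [this]
        exact Function.invFun_eq (hπ v hv)
  refine ⟨j, hjp, hjq, fun v hv w hw h => π.injective ?_⟩
  rw [← hj v hv, ← hj w hw]
  exact h

namespace IsCongruence

variable {R : Transf n → Transf n → Prop}

theorem mem_right (hR : IsCongruence S R) {f g : Transf n} (h : R f g) : g ∈ S :=
  hR.mem_left (hR.symm h)

/-- A point separating f from g yields two distinct related constants; as r is at least 2, S can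
move these two points anywhere. -/
theorem collapsed_one (hR : IsCongruence S R) (hS : IsSingularSemigroup a S)
    (ha : ¬ Function.Injective a) (h2 : 2 ≤ rank a) {f g : Transf n} (h : R f g) (hne : f ≠ g) :
    Collapsed S R 1 := by
  obtain ⟨x, hx⟩ : ∃ x, f x ≠ g x := by
    by_contra hc
    push Not at hc
    exact hne (DFunLike.ext _ _ hc)
  have hc : R (const (f x)) (const (g x)) := hR.mul_left (hS.const_mem x) h
  intro b hb c hc' hb1 hc1
  rw [eq_const_of_rank_le_one hb1 x, eq_const_of_rank_le_one hc1 x]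
  obtain ⟨s, hs, hsz⟩ := hS.exists_eqOn ha (A := {f x, g x}) (by rwa [Set.ncard_pair hx])
    (fun z => if z = f x then b x else c x)
  have h1 := hR.mul_right hs hc
  have e1 : const (f x) * s = const (b x) := by
    change const (s (f x)) = _
    rw [hsz _ (by simp), if_pos rfl]
  have e2 : const (g x) * s = const (c x) := by
    change const (s (g x)) = _
    rw [hsz _ (by simp), if_neg (Ne.symm hx)]
  rwa [e1, e2] at h1

/-- The rank of the smaller partner is lowered repeatedly while that of the larger one is kept. -/
theorem exists_rank_le_one (hR : IsCongruence S R) (hS : IsSingularSemigroup a S)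
    (ha : ¬ Function.Injective a) {f h : Transf n} (hfh : R f h) (hlt : rank h < rank f) :
    ∃ f' h', R f' h' ∧ rank f' = rank f ∧ rank h' ≤ 1 := by
  induction hl : rank h using Nat.strong_induction_on generalizing f h with
  | _ l ih =>
    by_cases hl1 : l ≤ 1
    · exact ⟨f, h, hfh, rfl, hl.trans_le hl1⟩
    obtain ⟨y, hy, hfy⟩ := hS.exists_regular_inverse (hR.mem_left hfh)
    have hR' : R f (h * (y * f)) := by
      have := hR.mul_right (S.mul_mem hy (hR.mem_left hfh)) hfh
      rwa [← mul_assoc, ← hfy] at this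
    have hle := rank_mul_le_left h (y * f)
    rcases lt_or_eq_of_le hle with hlt' | heq
    · exact ih _ (hl ▸ hlt') hR' (hlt'.trans hlt) rfl
    set k := h * (y * f) with hk
    have hsub : Set.range k ⊆ Set.range f := by
      rintro _ ⟨z, rfl⟩
      exact ⟨y (h z), rfl⟩
    obtain ⟨p, hp, q, hq, hpq⟩ := (Set.one_lt_ncard (s := Set.range k)).1 (by
      change 1 < rank k
      omega)
    obtain ⟨u, v, huv, hfuv⟩ := exists_apply_eq_of_rank_lt (f := f) (h := k) (by omega)
    -- Here s sends p, q to points u, v that k merges but f separates. So fsf keeps the rank of f,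
    -- while ksk also merges p with q and loses rank.
    obtain ⟨j, hjp, hjq, hj⟩ := exists_twisted_section (hsub hp) (hsub hq) hpq hfuv
    obtain ⟨s, hs, hsj⟩ := hS.exists_eqOn ha (hS.rank_le (hR.mem_left hfh)) j
    have hRs : R (f * (s * f)) (k * (s * k)) :=
      hR.trans (hR.mul_right (S.mul_mem hs (hR.mem_left hfh)) hR')
        (hR.mul_left (hR.mem_right hR') (hR.mul_left hs hR'))
    have hr1 : rank (f * (s * f)) = rank f := by
      rw [rank_mul_eq_iff]
      intro z hz w hw hzw
      rw [mul_apply, mul_apply, hsj z hz, hsj w hw] at hzw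
      exact hj hz hw hzw
    have hr2 : rank (k * (s * k)) < rank k := rank_mul_lt hp hq hpq (by
      rw [mul_apply s k p, mul_apply s k q, hsj p (hsub hp), hsj q (hsub hq), hjp, hjq, huv])
    obtain ⟨f', h', h1, h2, h3⟩ := ih _ (by omega) hRs (by omega) rfl
    exact ⟨f', h', h1, h2.trans hr1, h3⟩

/-- Every element of rank at most that of f is sf't, hence related to sh't of rank at most one; the
constants are all related. -/
theorem collapsed_of_rank_lt (hR : IsCongruence S R) (hS : IsSingularSemigroup a S)
    (ha : ¬ Function.Injective a) (h2 : 2 ≤ rank a) {f g : Transf n} (h : R f g)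
    (hlt : rank g < rank f) : Collapsed S R (rank f) := by
  have h1 := hR.collapsed_one hS ha h2 h (by rintro rfl; exact lt_irrefl _ hlt)
  obtain ⟨f', h', hR', hr, hr'⟩ := hR.exists_rank_le_one hS ha h hlt
  have key : ∀ d ∈ S, rank d ≤ rank f → ∃ c ∈ S, R d c ∧ rank c ≤ 1 := by
    intro d hd hdr
    obtain ⟨s, hs, t, ht, rfl⟩ := hS.exists_eq_mul_mul (hR.mem_left hR') hd (hdr.trans hr.ge)
    have := hR.mul_right ht (hR.mul_left hs hR')
    exact ⟨_, hR.mem_right this, this,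
      (rank_mul_le_left _ _).trans ((rank_mul_le_right _ _).trans hr')⟩
  intro d hd e he hdr her
  obtain ⟨c, hc, hdc, hcr⟩ := key d hd hdr
  obtain ⟨c', hc', hec, hcr'⟩ := key e he her
  exact hR.trans hdc (hR.trans (h1 c hc c' hc' hcr hcr') (hR.symm hec))

theorem collapsed_of_merge (hR : IsCongruence S R) (hS : IsSingularSemigroup a S)
    (ha : ¬ Function.Injective a) (h2 : 2 ≤ rank a) {f g : Transf n} (h : R f g)
    (hr : rank f = rank g) {s : Transf n} (hs : s ∈ S) (hi : Set.InjOn s (Set.range f))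
    {p q : Fin n} (hp : p ∈ Set.range g) (hq : q ∈ Set.range g) (hpq : p ≠ q) (hsp : s p = s q) :
    Collapsed S R (rank f) := by
  have hf := (rank_mul_eq_iff f s).2 hi
  have hg := rank_mul_lt hp hq hpq hsp
  rw [← hf]
  exact hR.collapsed_of_rank_lt hS ha h2 (hR.mul_right hs h) (by omega)

/-- If g merges x and y but f does not, a twisted section s of f sending f x to x and f y to y makes
fsf keep its rank while fsg loses rank. -/
theorem collapsed_of_kernel_ne (hR : IsCongruence S R) (hS : IsSingularSemigroup a S)
    (ha : ¬ Function.Injective a) (h2 : 2 ≤ rank a) {f g : Transf n} (h : R f g)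
    (hr : rank f = rank g) (hk : kernel f ≠ kernel g) : Collapsed S R (rank f) := by
  obtain ⟨x, y, hg, hf⟩ : ∃ x y, g x = g y ∧ f x ≠ f y := by
    by_contra hc
    push Not at hc
    exact hk (kernel_eq_iff.2 fun x y => (KerLe.ker_eq (a := g) hc hr.symm x y).symm)
  obtain ⟨j, hjx, hjy, hj⟩ := exists_twisted_section ⟨x, rfl⟩ ⟨y, rfl⟩ hf hf
  obtain ⟨s, hs, hsj⟩ := hS.exists_eqOn ha (hS.rank_le (hR.mem_left h)) j
  have hfs := hR.mul_left (S.mul_mem (hR.mem_left h) hs) h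
  have hr1 : rank (f * s * f) = rank f := by
    rw [mul_assoc, rank_mul_eq_iff]
    intro z hz w hw hzw
    rw [mul_apply, mul_apply, hsj z hz, hsj w hw] at hzw
    exact hj hz hw hzw
  have hr2 : rank (f * s * g) < rank f := by
    rw [mul_assoc]
    refine rank_mul_lt ⟨x, rfl⟩ ⟨y, rfl⟩ hf ?_
    rw [mul_apply, mul_apply, hsj _ ⟨x, rfl⟩, hsj _ ⟨y, rfl⟩, hjx, hjy, hg]
  rw [← hr1]
  exact hR.collapsed_of_rank_lt hS ha h2 hfs (by omega)

/-- In all other cases some element of S is injective on the image of f but merges two points of the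
image of g, and `collapsed_of_merge` applies. -/
theorem range_eq_or (hR : IsCongruence S R) (hS : IsSingularSemigroup a S)
    (ha : ¬ Function.Injective a) (h2 : 2 ≤ rank a) {f g : Transf n} (h : R f g)
    (hr : rank f = rank g) (hm : 2 ≤ rank f) (hc : ¬ Collapsed S R (rank f)) :
    Set.range f = Set.range g ∨ (rank f = rank a ∧ Disjoint (Set.range f) (Set.range g) ∧
      ∀ x y z, a x = a y → a x = a z → x = y ∨ x = z ∨ y = z) := by
  by_contra hcon
  push Not at hcon
  obtain ⟨hne, hcon⟩ := hcon
  obtain ⟨y, hyg, hyf⟩ : ∃ y ∈ Set.range g, y ∉ Set.range f := by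
    by_contra hn
    push Not at hn
    exact hne (Set.eq_of_subset_of_ncard_le hn hr.le).symm
  have hfr := hS.rank_le (hR.mem_left h)
  have hdisj : Disjoint (Set.range f) (Set.range g) := by
    rw [Set.disjoint_left]
    -- For a common image point x, the retraction moving y to x merges two points of the image of g.
    intro x hxf hxg
    obtain ⟨s, hs, hfix, hsy⟩ := hS.exists_retract ha hfr hxf hyf
    refine hc (hR.collapsed_of_merge hS ha h2 h hr hs (fun u hu v hv e => ?_) hyg hxg
      (by rintro rfl; exact hyf hxf) (by rw [hsy, hfix x hxf]))
    rwa [hfix u hu, hfix v hv] at e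
  obtain ⟨p, hp, q, hq, hpq⟩ := (Set.one_lt_ncard (s := Set.range g)).1 (by
    change 1 < rank g
    omega)
  have hpf : p ∉ Set.range f := fun hpf => Set.disjoint_left.1 hdisj hpf hp
  have hqf : q ∉ Set.range f := fun hqf => Set.disjoint_left.1 hdisj hqf hq
  have hmem : ∀ k : Equiv.Perm (Fin n), ofPerm k * a ∈ S := hS.ofPerm_mul_mem hS.self_mem
  rcases lt_or_eq_of_le hfr with hlt | heq
  · obtain ⟨u, v, huv, hne'⟩ : ∃ u v, a u = a v ∧ u ≠ v := by
      simpa [Function.Injective] using ha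
    obtain ⟨k, hkp, hkq, hki, -⟩ := exists_perm_merge a hne' huv hpq hpf hqf hlt
    refine hc (hR.collapsed_of_merge hS ha h2 h hr (hmem k) hki hp hq hpq ?_)
    rw [mul_apply, mul_apply, ofPerm_apply, ofPerm_apply, hkp, hkq, huv]
  · obtain ⟨u, v, w, huv, huw, hn1, hn2, hn3⟩ := hcon heq hdisj
    obtain ⟨z, hz⟩ : (Set.range f).Nonempty := by
      rw [← Set.ncard_pos]
      change 0 < rank f
      omega
    obtain ⟨k, hkp, hkq, hki, hkn⟩ := exists_perm_merge a hn1 huv hpq (A := Set.range f \ {z})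
      (fun e => hpf e.1) (fun e => hqf e.1) (by
        rw [Set.ncard_sdiff_singleton_add_one hz]; exact hfr)
    have hzp : k z ≠ u := fun e => hpf (k.injective (e.trans hkp.symm) ▸ hz)
    have hzq : k z ≠ v := fun e => hqf (k.injective (e.trans hkq.symm) ▸ hz)
    -- With rank f = r, the image of f needs every kernel class of `a`, including the one containing
    -- p and q. The third point w of that class makes room for z.
    let l : Equiv.Perm (Fin n) := Equiv.swap (k z) w * k
    have hlz : l z = w := Equiv.swap_apply_left _ _
    have hl : ∀ t, t ≠ z → k t ≠ w → l t = k t := fun t ht htw =>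
      Equiv.swap_apply_of_ne_of_ne (fun e => ht (k.injective e)) htw
    have hlp : l p = u := by
      rw [hl p (by rintro rfl; exact hpf hz) (by rwa [hkp]), hkp]
    have hlq : l q = v := by
      rw [hl q (by rintro rfl; exact hqf hz) (by rwa [hkq]), hkq]
    have hlA : ∀ t ∈ Set.range f, t ≠ z → l t = k t := fun t ht htz =>
      hl t htz fun e => hkn t ⟨ht, htz⟩ (by rw [e, huw])
    refine hc (hR.collapsed_of_merge hS ha h2 h hr (hmem l) (fun s hs t ht e => ?_) hp hq hpq ?_)
    · rw [mul_apply, mul_apply, ofPerm_apply, ofPerm_apply] at e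
      by_cases hsz : s = z <;> by_cases htz : t = z
      · rw [hsz, htz]
      · rw [hsz, hlz, hlA t ht htz, ← huw] at e
        exact absurd e.symm (hkn t ⟨ht, htz⟩)
      · rw [htz, hlz, hlA s hs hsz, ← huw] at e
        exact absurd e (hkn s ⟨hs, hsz⟩)
      · rw [hlA s hs hsz, hlA t ht htz] at e
        exact hki ⟨hs, hsz⟩ ⟨ht, htz⟩ e
    · rw [mul_apply, mul_apply, ofPerm_apply, ofPerm_apply, hlp, hlq, huv]

/-- Left multiplication by q followed by a section of p replaces p by q. With `transport_right`, one
related pair yields all pairs of the same shape. -/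
theorem transport_left (hR : IsCongruence S R) (hS : IsSingularSemigroup a S) {k : ℕ}
    {u v : Fin k ↪ Fin n} {p q : Fin n → Fin k} (hp : Function.Surjective p)
    (hq : factor u q ∈ S) (h : R (factor u p) (factor v p)) : R (factor u q) (factor v q) := by
  obtain ⟨s, hs⟩ := hp.hasRightInverse
  have hd : (⟨fun x => s (q x)⟩ : Transf n) ∈ S :=
    hS.mem_of_kerLe hq fun x y hxy => congrArg s ((factor_eq_iff u q x y).1 hxy)
  have h1 := hR.mul_left hd h
  have key : ∀ w : Fin k ↪ Fin n, (⟨fun x => s (q x)⟩ : Transf n) * factor w p = factor w q :=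
    fun w => DFunLike.ext _ _ fun x => congrArg w (hs (q x))
  rwa [key, key] at h1

theorem transport_right (hR : IsCongruence S R) (hS : IsSingularSemigroup a S)
    (ha : ¬ Function.Injective a) {k : ℕ} (hk : k ≤ rank a)
    {u : Fin k ↪ Fin n} (w : Fin k ↪ Fin n) {p q : Fin n → Fin k}
    (h : R (factor u p) (factor u q)) : R (factor w p) (factor w q) := by
  obtain ⟨t, ht, htu⟩ := hS.exists_eqOn ha (A := Set.range u)
    (by rwa [ncard_range_embedding]) (Function.extend u w id)
  have h1 := hR.mul_right ht h
  have key : ∀ p : Fin n → Fin k, factor u p * t = factor w p := fun p =>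
    DFunLike.ext _ _ fun x => by
      change t (u (p x)) = w (p x)
      rw [htu _ ⟨_, rfl⟩, u.injective.extend_apply]
  rwa [key, key] at h1

/-- If two distinct elements of rank `m` are related, then all the elements of rank less than `m`
are related. -/
theorem collapsed_pred (hR : IsCongruence S R) (hS : IsSingularSemigroup a S)
    (ha : ¬ Function.Injective a) (h2 : 2 ≤ rank a) {f g : Transf n} (h : R f g) (hne : f ≠ g)
    (hr : rank f = rank g) (hm : 2 ≤ rank f) : Collapsed S R (rank f - 1) := by
  classical
  by_cases hc : Collapsed S R (rank f)
  · exact hc.mono (Nat.sub_le _ _)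
  have hfr := hS.rank_le (hR.mem_left h)
  have hk : kernel f = kernel g := by
    by_contra hk
    exact hc (hR.collapsed_of_kernel_ne hS ha h2 h hr hk)
  obtain ⟨u, p, hp, hf⟩ := exists_eq_factor (b := f) rfl
  obtain ⟨v, hg⟩ := exists_eq_factor_of_kernel (f := g) hp fun x y => by
    rw [← factor_eq_iff u p, ← hf]
    exact kernel_eq_iff.1 hk x y
  obtain ⟨i, hi⟩ : ∃ i, u i ≠ v i := by
    by_contra hcon
    push Not at hcon
    exact hne (by rw [hf, hg]; exact DFunLike.ext _ _ fun x => hcon (p x))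
  have : Nontrivial (Fin (rank f)) := Fin.nontrivial_iff_two_le.2 hm
  obtain ⟨i', hi'⟩ := exists_ne i
  -- Merging label i with i' deletes u i and v i from the images. The resulting related pair has
  -- rank one less, and its images differ.
  let c : Fin (rank f) → Fin (rank f) := fun j => if j = i then i' else j
  have hrc : ∀ w : Fin (rank f) ↪ Fin n, Set.range (factor w (c ∘ p)) = Set.range w \ {w i} := by
    intro w
    ext z
    constructor
    · rintro ⟨x, rfl⟩
      refine ⟨⟨_, rfl⟩, fun e => ?_⟩
      have e' : c (p x) = i := w.injective e
      simp only [c] at e'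
      split_ifs at e' with h1
      · exact hi' e'
      · exact h1 e'
    · rintro ⟨⟨j, rfl⟩, hj⟩
      obtain ⟨x, rfl⟩ := hp j
      exact ⟨x, congrArg w (if_neg fun e => hj (by rw [e]; rfl))⟩
  have hrk : ∀ w : Fin (rank f) ↪ Fin n, rank (factor w (c ∘ p)) = rank f - 1 := fun w => by
    rw [rank, hrc, Set.ncard_sdiff_singleton_of_mem (Set.mem_range_self i), ncard_range_embedding]
  have huS : factor u p ∈ S := hf ▸ hR.mem_left h
  have hR2 : R (factor u (c ∘ p)) (factor v (c ∘ p)) := by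
    refine hR.transport_left hS hp (hS.mem_of_kerLe huS fun x y hxy => ?_) ?_
    · rw [factor_eq_iff] at hxy ⊢
      exact congrArg c hxy
    · rw [← hf, ← hg]; exact h
  have hrf : Set.range f = Set.range u := (congrArg (fun t : Transf n => Set.range t) hf).trans
    (range_factor u hp)
  have hrg : Set.range g = Set.range v := (congrArg (fun t : Transf n => Set.range t) hg).trans
    (range_factor v hp)
  have hrne : Set.range (factor u (c ∘ p)) ≠ Set.range (factor v (c ∘ p)) := by
    rw [hrc, hrc]
    rcases hR.range_eq_or hS ha h2 h hr hm hc with heq | ⟨-, hd, -⟩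
    · rw [hrf, hrg] at heq
      intro e
      have h1 : v i ∈ Set.range u \ {u i} := ⟨heq ▸ ⟨i, rfl⟩, fun e => hi (Eq.symm e)⟩
      rw [e] at h1
      exact h1.2 rfl
    · rw [hrf, hrg] at hd
      intro e
      have h1 : u i' ∈ Set.range u \ {u i} := ⟨⟨i', rfl⟩, fun e => hi' (u.injective e)⟩
      rw [e] at h1
      exact Set.disjoint_left.1 hd ⟨i', rfl⟩ h1.1
  -- `range_eq_or` needs rank at least 2, so rank f = 2 is separate. Otherwise distinct images
  -- without a collapse would force the reduced rank to be r, but it is smaller.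
  rcases Nat.lt_or_ge (rank f) 3 with h3 | h3
  · have : rank f - 1 = 1 := by omega
    rw [this]
    exact hR.collapsed_one hS ha h2 h hne
  · by_contra hc2
    rcases hR.range_eq_or hS ha h2 hR2 (by rw [hrk, hrk]) (by rw [hrk]; omega)
      (by rwa [hrk]) with e | ⟨e, -⟩
    · exact hrne e
    · rw [hrk] at e
      omega

end IsCongruence

end Transf

/-! ### Classification of the congruences. -/

namespace Transf

variable {n : ℕ} {a : Transf n} {S : Subsemigroup (Transf n)}

/-- Two disjoint sets of size `rank a` are complementary transversals, if no three points lie in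
one kernel class of `a`. -/
theorem fibre_two_of_disjoint {A B : Set (Fin n)} (hA : A.ncard = rank a) (hB : B.ncard = rank a)
    (hd : Disjoint A B) (h3 : ∀ x y z, a x = a y → a x = a z → x = y ∨ x = z ∨ y = z) :
    B = Aᶜ ∧ ∀ x : Fin n, {y : Fin n | a y = a x}.ncard = 2 := by
  classical
  -- Fibres have at most two points, so n ≤ 2r; A and B give 2r ≤ n. Equality makes every fibre have
  -- exactly two points and A ∪ B everything.
  have hle : ∀ v ∈ (Finset.univ : Finset (Fin n)).image a,
      ((Finset.univ : Finset (Fin n)).filter fun y => a y = v).card ≤ 2 := by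
    intro v _
    by_contra hc
    push Not at hc
    obtain ⟨x, y, z, hx, hy, hz, h1, h2, h4⟩ := Finset.two_lt_card_iff.1 hc
    simp only [Finset.mem_filter, Finset.mem_univ, true_and] at hx hy hz
    rcases h3 x y z (hx.trans hy.symm) (hx.trans hz.symm) with h | h | h
    · exact h1 h
    · exact h2 h
    · exact h4 h
  have hcard : ((Finset.univ : Finset (Fin n)).image a).card = rank a := by
    rw [rank, ← Set.ncard_coe_finset, Finset.coe_image, Finset.coe_univ, Set.image_univ]
  have hsum : n = ∑ v ∈ (Finset.univ : Finset (Fin n)).image a,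
      ((Finset.univ : Finset (Fin n)).filter fun y => a y = v).card := by
    conv_lhs => rw [← Fintype.card_fin n, ← Finset.card_univ]
    exact Finset.card_eq_sum_card_image a Finset.univ
  have hun : (A ∪ B).ncard = rank a * 2 := by
    rw [Set.ncard_union_eq hd, hA, hB, mul_two]
  have hn : rank a * 2 ≤ n := by
    rw [← hun]
    simpa using Set.ncard_le_card (A ∪ B)
  have hsum2 : ∑ v ∈ (Finset.univ : Finset (Fin n)).image a, 2 = rank a * 2 := by
    rw [Finset.sum_const, hcard, smul_eq_mul]
  have hle2 := Finset.sum_le_sum hle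
  rw [← hsum, hsum2] at hle2
  constructor
  · have huniv : A ∪ B = Set.univ := Set.eq_of_subset_of_ncard_le (Set.subset_univ _) (by
      rw [Set.ncard_univ, Nat.card_eq_fintype_card, Fintype.card_fin, hun]; exact hle2)
    ext x
    refine ⟨fun hx hx' => Set.disjoint_left.1 hd hx' hx, fun hx => ?_⟩
    have : x ∈ A ∪ B := huniv ▸ Set.mem_univ x
    exact this.resolve_left hx
  · intro x
    have := (Finset.sum_eq_sum_iff_of_le hle).1 (by rw [← hsum, hsum2]; omega) (a x)
      (Finset.mem_image_of_mem _ (Finset.mem_univ x))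
    rw [← this, ← Set.ncard_coe_finset]
    simp

theorem exists_eq_factor_of_range {k : ℕ} {f : Transf n} {u : Fin k ↪ Fin n}
    (h : Set.range f = Set.range u) :
    ∃ q : Fin n → Fin k, Function.Surjective q ∧ f = factor u q := by
  have h1 : ∀ x, ∃ i, u i = f x := fun x => h.le ⟨x, rfl⟩
  choose q hq using h1
  refine ⟨q, fun i => ?_, DFunLike.ext _ _ fun x => (hq x).symm⟩
  obtain ⟨x, hx⟩ := h.ge ⟨i, rfl⟩
  exact ⟨x, u.injective ((hq x).trans hx)⟩

theorem range_eq_of_eq_factor {k : ℕ} {f : Transf n} {u : Fin k ↪ Fin n} {p : Fin n → Fin k}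
    (hp : Function.Surjective p) (h : f = factor u p) : Set.range f = Set.range u := by
  rw [h, range_factor u hp]

/-- If the kernel classes of `a` have two elements, then any matching of two disjoint sets of
size `rank a` is the kernel on these sets of an element of `S`. -/
theorem IsSingularSemigroup.exists_matching (hS : IsSingularSemigroup a S)
    (h2 : ∀ x : Fin n, {y : Fin n | a y = a x}.ncard = 2) {u v w : Fin (rank a) ↪ Fin n}
    (hd : Disjoint (Set.range u) (Set.range v)) (σ : Equiv.Perm (Fin (rank a))) :
    ∃ s ∈ S, (∀ i, s (u i) = w i) ∧ ∀ i, s (v i) = w (σ i) := by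
  obtain ⟨α, π, hπ, hα⟩ := exists_eq_factor (b := a) rfl
  have hfib : ∀ i, ∃ x y, x ≠ y ∧ π x = i ∧ π y = i := by
    intro i
    obtain ⟨x, rfl⟩ := hπ i
    obtain ⟨y, hy, z, hz, hyz⟩ := (Set.one_lt_ncard (s := {y : Fin n | a y = a x})).1 (by
      rw [h2]; norm_num)
    have key : ∀ t, a t = a x → π t = π x := fun t ht => by
      rw [← factor_eq_iff α π, ← hα]; exact ht
    exact ⟨y, z, hyz, key y hy, key z hz⟩
  choose x y hxy hx hy using hfib
  -- x i and y i are two points of the i-th kernel class. Sending u i to x i and v i to y (σ i)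
  -- places each matched pair in one class.
  let F : Fin n → Fin n := Function.extend u x (Function.extend v (fun i => y (σ i)) id)
  have hFu : ∀ i, F (u i) = x i := fun i => u.injective.extend_apply _ _ i
  have hFv : ∀ i, F (v i) = y (σ i) := fun i => by
    have : ¬ ∃ j, u j = v i := fun hj => Set.disjoint_left.1 hd hj ⟨i, rfl⟩
    simp only [F]
    rw [Function.extend_apply' _ _ _ this, v.injective.extend_apply]
  have hxi : ∀ i j, x i = x j → i = j := fun i j h => by rw [← hx i, h, hx]
  have hyi : ∀ i j, y i = y j → i = j := fun i j h => by rw [← hy i, h, hy]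
  have hxyi : ∀ i j, x i ≠ y j := fun i j h => by
    have hij : i = j := by rw [← hx i, h, hy]
    subst hij
    exact hxy i h
  obtain ⟨g, hg⟩ := exists_perm_eqOn (Set.range u ∪ Set.range v) F (by
    rintro _ (⟨i, rfl⟩ | ⟨i, rfl⟩) _ (⟨j, rfl⟩ | ⟨j, rfl⟩) h <;> simp only [hFu, hFv] at h
    · rw [hxi _ _ h]
    · exact absurd h (hxyi _ _)
    · exact absurd h.symm (hxyi _ _)
    · rw [σ.injective (hyi _ _ h)])
  have hs : ∀ z, (ofPerm g * a * ⟨Function.extend α w id⟩ : Transf n) z = w (π (g z)) := fun z => by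
    change Function.extend α w id (a (g z)) = _
    have : a (g z) = α (π (g z)) := DFunLike.congr_fun hα _
    rw [this, α.injective.extend_apply]
  refine ⟨_, hS.mul_mem_right (hS.ofPerm_mul_mem hS.self_mem g) ⟨Function.extend α w id⟩,
    fun i => ?_, fun i => ?_⟩
  · rw [hs, hg _ (Or.inl ⟨i, rfl⟩), hFu, hx]
  · rw [hs, hg _ (Or.inr ⟨i, rfl⟩), hFv, hy]

namespace IsCongruence

variable {R : Transf n → Transf n → Prop}

/-- The permutations that relate elements of rank `k` with the same kernel and image. -/
def permGroup (hR : IsCongruence S R) (hS : IsSingularSemigroup a S) (k : ℕ) :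
    Subgroup (Equiv.Perm (Fin k)) where
  carrier := {σ | ∀ (p : Fin n → Fin k) (u : Fin k ↪ Fin n), Function.Surjective p →
    factor u p ∈ S → R (factor u p) (factor u (σ ∘ p))}
  one_mem' _ _ _ h := hR.refl h
  mul_mem' {σ τ} hσ hτ p u hp h := hR.trans (hτ p u hp h)
    (hσ (τ ∘ p) u (τ.surjective.comp hp) ((factor_perm_mem_iff hS u u p τ).1 h))
  inv_mem' {σ} hσ p u hp h := by
    have h1 := hσ ((σ⁻¹ : Equiv.Perm (Fin k)) ∘ p) u (σ⁻¹.surjective.comp hp)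
      ((factor_perm_mem_iff hS u u p σ⁻¹).1 h)
    have h2 : σ ∘ (σ⁻¹ : Equiv.Perm (Fin k)) ∘ p = p := funext fun x => σ.apply_symm_apply _
    rw [h2] at h1
    exact hR.symm h1

theorem permGroup_normal (hR : IsCongruence S R) (hS : IsSingularSemigroup a S) (k : ℕ) :
    (hR.permGroup hS k).Normal where
  conj_mem σ hσ τ p u hp h := by
    have h1 := hσ ((τ⁻¹ : Equiv.Perm (Fin k)) ∘ p) (τ.toEmbedding.trans u) (τ⁻¹.surjective.comp hp)
      ((factor_perm_mem_iff hS u _ p τ⁻¹).1 h)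
    have h2 : factor (τ.toEmbedding.trans u) ((τ⁻¹ : Equiv.Perm (Fin k)) ∘ p) = factor u p :=
      DFunLike.ext _ _ fun x => congrArg u (τ.apply_symm_apply _)
    rw [h2] at h1
    exact h1

theorem mem_permGroup_of_rel (hR : IsCongruence S R) (hS : IsSingularSemigroup a S)
    (ha : ¬ Function.Injective a) {k : ℕ} (hk : k ≤ rank a) {u : Fin k ↪ Fin n}
    {p : Fin n → Fin k} (hp : Function.Surjective p) {σ : Equiv.Perm (Fin k)}
    (h : R (factor u p) (factor u (σ ∘ p))) : σ ∈ hR.permGroup hS k := by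
  intro q w hq hwq
  have hu : factor u q ∈ S := (factor_perm_mem_iff hS u w q 1).2 hwq
  have h1 := hR.transport_left hS (v := σ.toEmbedding.trans u) hp hu h
  exact hR.transport_right hS ha hk w (q := σ ∘ q) h1

/-- If not all the elements of rank at most `k` are related, then two distinct related elements
have rank less than `k`, or rank `k`, the same kernel, and equal or complementary images. -/
theorem rank_of_rel (hR : IsCongruence S R) (hS : IsSingularSemigroup a S)
    (ha : ¬ Function.Injective a) (h2 : 2 ≤ rank a) {k : ℕ} (hk2 : 2 ≤ k)
    (hk : ¬ Collapsed S R k) {f g : Transf n} (h : R f g) :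
    f = g ∨ (rank f < k ∧ rank g < k) ∨ (rank f = k ∧ rank g = k ∧ kernel f = kernel g ∧
      (Set.range f = Set.range g ∨ (rank f = rank a ∧ Disjoint (Set.range f) (Set.range g) ∧
        ∀ x y z, a x = a y → a x = a z → x = y ∨ x = z ∨ y = z))) := by
  by_cases hne : f = g
  · exact Or.inl hne
  refine Or.inr ?_
  have hcol : ∀ m, Collapsed S R m → m < k := fun m hm => by
    by_contra hc
    exact hk (hm.mono (by omega))
  rcases lt_trichotomy (rank f) (rank g) with hlt | heq | hlt
  · have := hcol _ (hR.collapsed_of_rank_lt hS ha h2 (hR.symm h) hlt)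
    exact Or.inl (by omega)
  · by_cases hfk : rank f < k
    · exact Or.inl (by omega)
    · have h1 := hcol _ (hR.collapsed_pred hS ha h2 h hne heq (by omega))
      have hfk' : rank f = k := by omega
      have hc : ¬ Collapsed S R (rank f) := by rwa [hfk']
      refine Or.inr ⟨hfk', by omega, ?_, hR.range_eq_or hS ha h2 h heq (by omega) hc⟩
      by_contra hker
      exact hc (hR.collapsed_of_kernel_ne hS ha h2 h heq hker)
  · have := hcol _ (hR.collapsed_of_rank_lt hS ha h2 h hlt)
    exact Or.inl (by omega)

/-- The number k is the least rank at which not all elements are related. Lower ranks form one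
class, higher ranks are trivial, and at rank k the alternatives are equal images or the
complementary exception. -/
theorem classification (hR : IsCongruence S R) (hS : IsSingularSemigroup a S)
    (ha : ¬ Function.Injective a) (h2 : 2 ≤ rank a) :
    (∃ (k : ℕ) (N : Subgroup (Equiv.Perm (Fin k))), 1 ≤ k ∧ k ≤ rank a + 1 ∧ N.Normal ∧
        ∀ f ∈ S, ∀ g ∈ S, (R f g ↔ malcevRel k N f g)) ∨
      ((∀ x : Fin n, {y : Fin n | a y = a x}.ncard = 2) ∧
        ∃ P : Set (Set (Fin n)), (∀ A ∈ P, Aᶜ ∈ P) ∧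
          ∀ f ∈ S, ∀ g ∈ S, (R f g ↔ complementRel (rank a) P f g)) := by
  classical
  by_cases htriv : ∀ f g, R f g → f = g
  · refine Or.inl ⟨1, ⊥, le_rfl, by omega, inferInstance, fun f hf g hg => ⟨fun h => ?_, ?_⟩⟩
    · exact Or.inl (htriv f g h)
    · rw [malcevRel_iff]
      rintro (rfl | ⟨h, -⟩ | ⟨p, u, hp, σ, hσ, rfl, rfl⟩)
      · exact hR.refl hf
      · have : 0 < rank f := by
          obtain ⟨x, -⟩ : ∃ x y, a x = a y ∧ x ≠ y := by simpa [Function.Injective] using ha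
          exact (Set.ncard_pos).2 ⟨f x, x, rfl⟩
        omega
      · rw [Subgroup.mem_bot.1 hσ]
        exact hR.refl hf
  push Not at htriv
  obtain ⟨f₁, g₁, hfg₁, hne₁⟩ := htriv
  have hone := hR.collapsed_one hS ha h2 hfg₁ hne₁
  by_cases hall : Collapsed S R (rank a)
  · refine Or.inl ⟨rank a + 1, ⊤, by omega, le_rfl, inferInstance, fun f hf g hg => ⟨fun _ => ?_, fun _ => ?_⟩⟩
    · exact Or.inr (Or.inl ⟨Nat.lt_succ_of_le (hS.rank_le hf), Nat.lt_succ_of_le (hS.rank_le hg)⟩)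
    · exact hall f hf g hg (hS.rank_le hf) (hS.rank_le hg)
  have hex : ∃ m, ¬ Collapsed S R m := ⟨_, hall⟩
  obtain ⟨k, hk, hkmin⟩ : ∃ k, ¬ Collapsed S R k ∧ ∀ m < k, Collapsed S R m :=
    ⟨Nat.find hex, Nat.find_spec hex, fun m hm => not_not.1 (Nat.find_min hex hm)⟩
  have hkr : k ≤ rank a := by
    by_contra hc
    exact hall (hkmin _ (by omega))
  have hk2 : 2 ≤ k := by
    by_contra hc
    exact hk (hone.mono (by omega))
  have hlow : ∀ f ∈ S, ∀ g ∈ S, rank f < k ∧ rank g < k → R f g := fun f hf g hg h =>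
    hkmin (k - 1) (by omega) f hf g hg (by omega) (by omega)
  have hrel := fun {f g} (h : R f g) => hR.rank_of_rel hS ha h2 hk2 hk h
  by_cases hexc : ∀ f g, R f g → rank f = k → Set.range f = Set.range g
  · refine Or.inl ⟨k, hR.permGroup hS k, by omega, by omega, hR.permGroup_normal hS k,
      fun f hf g hg => ?_⟩
    rw [malcevRel_iff]
    constructor
    · intro h
      rcases hrel h with h1 | h1 | ⟨h1, -, hker, -⟩
      · exact Or.inl h1
      · exact Or.inr (Or.inl h1)
      · have hrg := hexc f g h h1
        obtain ⟨u, p, hp, rfl⟩ := exists_eq_factor h1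
        obtain ⟨σ, rfl⟩ := exists_perm_factor (f := g) (u := u) hp (fun x y => by
          rw [← kernel_eq_iff.1 hker x y, factor_eq_iff]) (by
          rw [← hrg, range_factor u hp])
        exact Or.inr (Or.inr ⟨p, u, hp, σ, hR.mem_permGroup_of_rel hS ha hkr hp h, rfl, rfl⟩)
    · rintro (rfl | h | ⟨p, u, hp, σ, hσ, rfl, rfl⟩)
      · exact hR.refl hf
      · exact hlow f hf g hg h
      · exact hσ p u hp hf
  push Not at hexc
  obtain ⟨f₀, g₀, hfg₀, hf₀k, hrne⟩ := hexc
  rcases hrel hfg₀ with rfl | hlt | ⟨-, hg₀k, hker₀, hr | ⟨hra, hd₀, hthree⟩⟩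
  · exact absurd rfl hrne
  · omega
  · exact absurd hr hrne
  have hka : k = rank a := hf₀k.symm.trans hra
  subst hka
  have htwo := (fibre_two_of_disjoint hf₀k hg₀k hd₀ hthree).2
  obtain ⟨u, p, hp, hf₀⟩ := exists_eq_factor hf₀k
  obtain ⟨v, hg₀⟩ := exists_eq_factor_of_kernel (f := g₀) hp fun x y => by
    rw [← kernel_eq_iff.1 hker₀ x y, hf₀, factor_eq_iff]
  -- One pair with complementary images already forces the full symmetric group: an element of S can
  -- match the two images along any permutation.
  have hfull : ∀ (w : Fin (rank a) ↪ Fin n) (q : Fin n → Fin (rank a))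
      (σ : Equiv.Perm (Fin (rank a))), factor w q ∈ S → R (factor w q) (factor w (σ ∘ q)) := by
    intro w q σ hwq
    have hd : Disjoint (Set.range u) (Set.range v) := by
      rwa [← range_eq_of_eq_factor hp hf₀, ← range_eq_of_eq_factor hp hg₀]
    obtain ⟨s, hs, hsu, hsv⟩ := hS.exists_matching htwo (w := w) hd σ
    have h1 := hR.mul_right hs hfg₀
    have e1 : f₀ * s = factor w p := DFunLike.ext _ _ fun x => by
      rw [hf₀]; exact hsu (p x)
    have e2 : g₀ * s = factor (σ.toEmbedding.trans w) p := DFunLike.ext _ _ fun x => by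
      rw [hg₀]; exact hsv (p x)
    rw [e1, e2] at h1
    exact hR.transport_left hS hp hwq h1
  refine Or.inr ⟨htwo, {A | ∃ f g, R f g ∧ rank f = rank a ∧ Set.range f = A ∧ Set.range g = Aᶜ ∧
    rank g = rank a}, ?_, fun f hf g hg => ⟨fun h => ?_, ?_⟩⟩
  · rintro A ⟨f, g, h, hf, hfA, hgA, hg⟩
    exact ⟨g, f, hR.symm h, hg, hgA, by rw [compl_compl, hfA], hf⟩
  · rcases hrel h with h1 | h1 | ⟨h1, h1', hker, hr | ⟨-, hd, -⟩⟩
    · exact Or.inl h1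
    · exact Or.inr (Or.inl h1)
    · exact Or.inr (Or.inr ⟨h1, h1', hker, Or.inl hr⟩)
    · have hc := (fibre_two_of_disjoint h1 h1' hd hthree).1
      exact Or.inr (Or.inr ⟨h1, h1', hker, Or.inr ⟨⟨f, g, h, h1, rfl, hc, h1'⟩, hc⟩⟩)
  · rintro (rfl | h | ⟨hfr, hgr, hker, hr | ⟨⟨f', g', h', hf'r, hff', hgg', hg'r⟩, hc⟩⟩)
    · exact hR.refl hf
    · exact hlow f hf g hg h
    · obtain ⟨w, q, hq, rfl⟩ := exists_eq_factor hfr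
      obtain ⟨σ, rfl⟩ := exists_perm_factor (f := g) (u := w) hq (fun x y => by
        rw [← kernel_eq_iff.1 hker x y, factor_eq_iff]) (by rw [← hr, range_factor w hq])
      exact hfull w q σ hf
    · have hker' : kernel f' = kernel g' := by
        rcases hrel h' with rfl | hlt | ⟨-, -, hk', -⟩
        · rfl
        · omega
        · exact hk'
      obtain ⟨u', p', hp', hfp⟩ := exists_eq_factor hf'r
      obtain ⟨v', hgp⟩ := exists_eq_factor_of_kernel (f := g') hp' fun x y => by
        rw [← kernel_eq_iff.1 hker' x y, hfp, factor_eq_iff]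
      obtain ⟨q, hq, rfl⟩ := exists_eq_factor_of_range (f := f) (u := u')
        (hff'.symm.trans (range_eq_of_eq_factor hp' hfp))
      -- Transporting the pair that witnesses membership in P relates f to a map with the image of
      -- g; the remaining permutation is handled by `hfull`.
      have h1 := hR.transport_left hS hp' hf (hfp ▸ hgp ▸ h')
      obtain ⟨σ, rfl⟩ := exists_perm_factor (f := g) (u := v') hq (fun x y => by
        rw [← kernel_eq_iff.1 hker x y, factor_eq_iff]) (by
        rw [hc, ← hgg', range_eq_of_eq_factor hp' hgp])
      exact hR.trans h1 (hfull v' q σ (hR.mem_right h1))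

end IsCongruence

theorem IsSingularSemigroup.congruence_iff (hS : IsSingularSemigroup a S) (ha : ¬ Function.Injective a)
    (R : S → S → Prop) : (∃ c : Con S, ∀ f g : S, c f g ↔ R f g) ↔
      (rank a = 1 ∧ Equivalence R) ∨
      (2 ≤ rank a ∧
        ((∃ (k : ℕ) (N : Subgroup (Equiv.Perm (Fin k))),
            1 ≤ k ∧ k ≤ rank a + 1 ∧ N.Normal ∧
            ∀ f g : S, R f g ↔ malcevRel k N (f : Transf n) (g : Transf n)) ∨
          ((∀ x : Fin n, {y : Fin n | a y = a x}.ncard = 2) ∧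
            ∃ P : Set (Set (Fin n)), (∀ A ∈ P, Aᶜ ∈ P) ∧
              ∀ f g : S, R f g ↔
                complementRel (rank a) P (f : Transf n) (g : Transf n)))) := by
  obtain ⟨x₀, -⟩ : ∃ x y, a x = a y ∧ x ≠ y := by simpa [Function.Injective] using ha
  constructor
  · rintro ⟨c, hc⟩
    obtain rfl : R = fun f g => c f g := funext₂ fun f g => propext (hc f g).symm
    have hpos : 0 < rank a := (Set.ncard_pos).2 ⟨a x₀, x₀, rfl⟩
    rcases Nat.lt_or_ge (rank a) 2 with h1 | h2
    · exact Or.inl ⟨by omega, c.iseqv⟩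
    · have hiff : ∀ f g : S, c f g ↔
          ∃ (hf : (f : Transf n) ∈ S) (hg : (g : Transf n) ∈ S), c ⟨f, hf⟩ ⟨g, hg⟩ := fun f g =>
        ⟨fun h => ⟨f.2, g.2, h⟩, fun ⟨_, _, h⟩ => h⟩
      refine Or.inr ⟨h2, ?_⟩
      rcases (isCongruence_of_con c).classification hS ha h2 with
        ⟨k, N, h1, hk, hN, h⟩ | ⟨htwo, P, hP, h⟩
      · exact Or.inl ⟨k, N, h1, hk, hN, fun f g => (hiff f g).trans (h f f.2 g g.2)⟩
      · exact Or.inr ⟨htwo, P, hP, fun f g => (hiff f g).trans (h f f.2 g g.2)⟩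
  · rintro (⟨h1, hR⟩ | ⟨-, ⟨k, N, -, -, hN, h⟩ | ⟨htwo, P, hP, h⟩⟩)
    · have hconst : ∀ s f : S, s * f = f := fun s f => Subtype.ext <| by
        have := eq_const_of_rank_le_one ((hS.rank_le f.2).trans h1.le) x₀
        change (s : Transf n) * (f : Transf n) = f
        rw [this]
        rfl
      refine exists_con hR (fun s f g hfg => ?_) (fun s f g hfg => ?_)
      · rwa [hconst, hconst]
      · rw [hconst, hconst]; exact hR.refl s
    · obtain rfl : R = fun f g : S => malcevRel k N (f : Transf n) (g : Transf n) :=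
        funext₂ fun f g => propext (h f g)
      exact exists_con ((malcevRel_equivalence hN).comap _) (fun s f g => malcevRel_mul_left s.1)
        (fun s f g => malcevRel_mul_right s.1)
    · obtain rfl : R = fun f g : S => complementRel (rank a) P (f : Transf n) (g : Transf n) :=
        funext₂ fun f g => propext (h f g)
      exact exists_con ((complementRel_equivalence hP).comap _)
        (fun s f g => complementRel_mul_left s.1)
        (fun s f g => complementRel_mul_right hS htwo s.2)

theorem image_kernel_subset_iff (a b : Transf n) (g : Equiv.Perm (Fin n)) :
    Prod.map g g '' kernel a ⊆ kernel b ↔ KerLe a (ofPerm g * b) := by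
  rw [Set.image_subset_iff]
  exact ⟨fun h x y hxy => h (a := (x, y)) hxy, fun h p hp => h p.1 p.2 hp⟩

end Transf

theorem theorem7p4 (n : ℕ) (a : Transf n) (G : Subgroup (Equiv.Perm (Fin n)))
    (h : Transf.IsPair (⊤ : Subgroup (Equiv.Perm (Fin n))) a G)
    (S : Subsemigroup (Transf n)) (hS : S = Transf.singularPart a G h.1) :
    -- description of the elements
    ((S : Set (Transf n)) =
      {b | ∃ g : Equiv.Perm (Fin n), Prod.map g g '' Transf.kernel a ⊆ Transf.kernel b}) ∧
    -- regularity
    (∀ x ∈ S, ∃ y ∈ S, x = x * y * x) ∧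
    -- generation by idempotents
    (S = Subsemigroup.closure {e | e ∈ S ∧ e * e = e}) ∧
    -- idempotents of the semigroup generated by the conjugates of `a`
    (∀ e : Transf n, e * e = e → (e ∈ S ↔ e ∈ Transf.conjGen a G)) ∧
    (S = Transf.conjGen a G) ∧
    -- constants
    ((∃ x : Fin n, Transf.const x ∈ Transf.gen a G) ∧
      MulAction.IsPretransitive G (Fin n) ∧
      ∀ x : Fin n, Transf.const x ∈ S) ∧
    -- automorphisms
    (∃ Φ : MulAut S ≃* Transf.normalizer S, ∀ (φ : MulAut S) (s : S),
      ((φ s : S) : Transf n) =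
        Transf.ofPerm (Φ φ : Equiv.Perm (Fin n))⁻¹ * (s : Transf n) *
          Transf.ofPerm (Φ φ : Equiv.Perm (Fin n))) ∧
    Nonempty (MulAut S ≃* Equiv.Perm (Fin n)) ∧
    -- congruences
    (∀ R : S → S → Prop, (∃ c : Con S, ∀ f g : S, c f g ↔ R f g) ↔
      (Transf.rank a = 1 ∧ Equivalence R) ∨
      (2 ≤ Transf.rank a ∧
        ((∃ (k : ℕ) (N : Subgroup (Equiv.Perm (Fin k))),
            1 ≤ k ∧ k ≤ Transf.rank a + 1 ∧ N.Normal ∧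
            ∀ f g : S, R f g ↔ Transf.malcevRel k N (f : Transf n) (g : Transf n)) ∨
          ((∀ x : Fin n, {y : Fin n | a y = a x}.ncard = 2) ∧
            ∃ P : Set (Set (Fin n)), (∀ A ∈ P, Aᶜ ∈ P) ∧
              ∀ f g : S, R f g ↔
                Transf.complementRel (Transf.rank a) P (f : Transf n) (g : Transf n))))) ∧
    -- the maximal subgroups
    (∀ e ∈ S, e * e = e →
      ∃ H : Subsemigroup (Transf n),
        (H : Set (Transf n)) = {f | f ∈ S ∧ Transf.kernel f = Transf.kernel e ∧
          Set.range f = Set.range e} ∧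
        Nonempty (H ≃* Equiv.Perm (Fin (Transf.rank e)))) ∧
    -- principal ideals and Green's relations
    (∀ b ∈ S, ∀ c ∈ S,
      (({b} * (S : Set (Transf n)) = {c} * (S : Set (Transf n))) ↔
        Transf.kernel b = Transf.kernel c) ∧
      (((S : Set (Transf n)) * {b} = (S : Set (Transf n)) * {c}) ↔
        Set.range b = Set.range c) ∧
      (((S : Set (Transf n)) * {b} * (S : Set (Transf n)) =
          (S : Set (Transf n)) * {c} * (S : Set (Transf n))) ↔
        Transf.rank b = Transf.rank c) ∧
      (Transf.GreenR S b c ↔ Transf.kernel b = Transf.kernel c) ∧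
      (Transf.GreenL S b c ↔ Set.range b = Set.range c) ∧
      (Transf.GreenJ S b c ↔ Transf.rank b = Transf.rank c)) := by
  open Transf in
  have ha := not_injective_of_not_mem_permSet h.1
  have hsing : IsSingularSemigroup a S := hS ▸ h.isSingularSemigroup
  have hidem : ∀ e : Transf n, e * e = e → (e ∈ S ↔ e ∈ conjGen a G) := by
    refine fun e hee => ⟨fun he => ?_, fun he => hsing.conjGen_le G he⟩
    rw [hS] at he
    rcases eq_conjGen_mul_of_mem_gen he.1 with he' | ⟨c, hc, g, hg, rfl⟩
    · exact absurd he' he.2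
    · exact mem_conjGen_of_idempotent hc hg hee
  have hgen := hsing.eq_idempotentClosure ha
  refine ⟨?_, fun x hx => hsing.exists_regular_inverse hx, hgen, hidem, ?_,
    ⟨?_, h.isPretransitive, hsing.const_mem⟩, hsing.exists_mulEquiv_normalizer,
    hsing.nonempty_mulAut_equiv, hsing.congruence_iff ha,
    fun e he hee => hsing.exists_maximal_subgroup he hee,
    fun b hb c hc => ⟨hsing.right_ideal_eq_iff hb hc, hsing.left_ideal_eq_iff hb hc,
      hsing.ideal_eq_iff hb hc, hsing.greenR_iff hb hc, hsing.greenL_iff hb hc,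
      hsing.greenJ_iff hb hc⟩⟩
  · ext b
    simp only [image_kernel_subset_iff]
    exact hsing b
  -- The idempotents of S generate it and all lie in `conjGen a G`.
  · refine le_antisymm ?_ (hsing.conjGen_le G)
    conv_lhs => rw [hgen]
    exact Subsemigroup.closure_le.2 fun e he => (hidem e he.2).1 he.1
  · obtain ⟨x, -⟩ : ∃ x y, a x = a y ∧ x ≠ y := by simpa [Function.Injective] using ha
    have hx := hsing.const_mem x
    rw [hS] at hx
    exact ⟨x, hx.1⟩
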